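/- A graph $\mathcal G=(V,E)$ here is a directed graph that contains all self-loops $i\to i$; it is a DAG if it has no directed cycle apart from the self-loops. For every $n\ge 0$ fix a diagonal positive definite matrix $C_n\in\mathbb R^{n\times n}$ (for instance $C_n=2I_n$). For a graph $\mathcal G=(V,E)$ with $V=\{1,\dots,n\}$ let $$\mathcal M_{\mathcal G}=\{\Sigma\in\mathrm{PD}_n : M\Sigma+\Sigma M^T+C_n=0 \text{ for some stable } M\in\mathbb R^{n\times n} \text{ with } m_{ji}=0 \text{ whenever } i\to j\notin E\},$$ where $\mathrm{PD}_n$ is the set of symmetric positive definite real $n\times n$ matrices and $M$ is stable if all its complex eigenvalues have negative real part. Two graphs $\mathcal G_1,\mathcal G_2$ on the same vertex set are model equivalent if $\mathcal M_{\mathcal G_1}=\mathcal M_{\mathcal G_2}$. A DAG $\mathcal G$ on $V$ is structurally identifiable within the class of Lyapunov DAG models if $\mathcal G$ is the only DAG on $V$ that is model equivalent to $\mathcal G$. Graphs are given to a Turing machine by their adjacency matrices. Then: 1. There is a Turing machine that decides, for every input DAG $\mathcal G$ (with any number $n$ of vertices), in time polynomial in the length of the input, whether $\mathcal G$ is structurally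 identifiable within the class of Lyapunov DAG models. 2. There is a Turing machine that decides, for every pair of input DAGs $\mathcal G_1,\mathcal G_2$ on the same vertex set, in time polynomial in the length of the input, whether $\mathcal G_1$ and $\mathcal G_2$ are model equivalent. -/

import Mathlib

open scoped Matrix

/-- A directed graph on the vertex set `V` that contains every self-loop `i → i`. -/
@[ext]
structure LoopedDigraph (V : Type) extends Digraph V where
  loop : ∀ i, Adj i i

namespace LoopedDigraph

/-- `G` is acyclic (a DAG) if the graph without its self-loops has no directed cycle. -/
def IsAcyclic {V : Type} (G : LoopedDigraph V) : Prop :=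
  ∀ i, ¬ Relation.TransGen (fun a b => a ≠ b ∧ G.Adj a b) i i

end LoopedDigraph

/-- A real square matrix is stable if all its complex eigenvalues have negative real part. -/
def IsStableMatrix {V : Type} [Fintype V] [DecidableEq V] (M : Matrix V V ℝ) : Prop :=
  ∀ z ∈ spectrum ℂ (M.map (fun x : ℝ => (x : ℂ))), z.re < 0

/-- `M ∈ ℝ^E`: the entry `M j i` vanishes unless `i → j` is an edge of `G`. -/
def IsSparseMatrix {V : Type} (G : LoopedDigraph V) (M : Matrix V V ℝ) : Prop :=
  ∀ i j, ¬ G.Adj i j → M j i = 0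

/-- The graphical continuous Lyapunov model of `G` with volatility matrix `C`, as the set of
covariance matrices of its (centred normal) distributions. -/
def lyapunovModel {V : Type} [Fintype V] [DecidableEq V] (G : LoopedDigraph V)
    (C : Matrix V V ℝ) : Set (Matrix V V ℝ) :=
  {S | S.PosDef ∧ ∃ M : Matrix V V ℝ,
    IsStableMatrix M ∧ IsSparseMatrix G M ∧ M * S + S * Mᵀ + C = 0}

/-- Model equivalence in the Lyapunov sense. -/
def ModelEquivalent {V : Type} [Fintype V] [DecidableEq V] (C : Matrix V V ℝ)
    (G H : LoopedDigraph V) : Prop :=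
  lyapunovModel G C = lyapunovModel H C

/-- `G ∈ L` is structurally identifiable within the class `L` of graphs over `V` if its model
equivalence class meets `L` in exactly one element. -/
def StructurallyIdentifiableWithin {V : Type} [Fintype V] [DecidableEq V] (C : Matrix V V ℝ)
    (L : Set (LoopedDigraph V)) (G : LoopedDigraph V) : Prop :=
  G ∈ L ∧ ∃! H : LoopedDigraph V, H ∈ L ∧ ModelEquivalent C G H

/-- The DAGs on the vertex set `{0, …, n - 1}`. -/
abbrev DAG (n : ℕ) : Type := {G : LoopedDigraph (Fin n) // G.IsAcyclic}

open scoped Classical in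
/-- The adjacency matrix of a graph as a list of rows; entry `j` of row `i` is the bit
`some b` with `b = true` iff `i → j` is an edge, and `none` marks the end of the row. -/
noncomputable def adjRows {n : ℕ} (G : LoopedDigraph (Fin n)) : List (List (Option Bool)) :=
  List.ofFn fun i : Fin n => (List.ofFn fun j : Fin n => some (decide (G.Adj i j))) ++ [none]

/-- The adjacency matrix of a graph as a word of length `n * (n + 1)` over a three-letter
alphabet, row by row. -/
noncomputable def encodeGraph {n : ℕ} (G : LoopedDigraph (Fin n)) : List (Option Bool) :=
  (adjRows G).flatten

/-- Encoding of the instances "a DAG". -/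
noncomputable def encodeDAG (x : Σ n : ℕ, DAG n) : List (Option Bool) :=
  encodeGraph x.2.1

/-- Encoding of the instances "two DAGs on the same vertex set": the word of the first graph
followed by the word of the second one, the latter written in a disjoint copy of the alphabet. -/
noncomputable def encodeDAGPair (x : Σ n : ℕ, DAG n × DAG n) :
    List (Option Bool ⊕ Option Bool) :=
  (encodeGraph x.2.1.1).map Sum.inl ++ (encodeGraph x.2.2.1).map Sum.inr

theorem length_encodeGraph {n : ℕ} (G : LoopedDigraph (Fin n)) :
    (encodeGraph G).length = n * (n + 1) := by
  simp [encodeGraph, adjRows, List.length_flatten, List.map_ofFn, Function.comp_def]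

theorem encodeGraph_injective {n : ℕ} :
    Function.Injective (encodeGraph : LoopedDigraph (Fin n) → List (Option Bool)) := by
  intro G H h
  have h1 : adjRows G = adjRows H := by
    rw [List.eq_iff_flatten_eq]
    exact ⟨h, by simp [adjRows, List.map_ofFn, Function.comp_def]⟩
  have h2 := List.ofFn_injective h1
  ext i j
  have h3 := congrFun h2 i
  have h4 := List.ofFn_injective (List.append_cancel_right h3)
  have h5 := congrFun h4 j
  simpa using h5

theorem encodeDAG_injective : Function.Injective encodeDAG := by
  rintro ⟨n, G⟩ ⟨m, H⟩ h
  have hl : n * (n + 1) = m * (m + 1) := by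
    rw [← length_encodeGraph G.1, ← length_encodeGraph H.1]
    exact congrArg List.length h
  obtain rfl : n = m := by
    rcases lt_trichotomy n m with h' | h' | h'
    · nlinarith
    · exact h'
    · nlinarith
  have : G = H := Subtype.ext (encodeGraph_injective h)
  rw [this]

theorem encodeDAGPair_injective : Function.Injective encodeDAGPair := by
  rintro ⟨n, G, G'⟩ ⟨m, H, H'⟩ h
  have h1 : encodeGraph G.1 = encodeGraph H.1 := by
    have := congrArg (List.filterMap Sum.getLeft?) h
    simpa [encodeDAGPair, List.filterMap_append, List.filterMap_map, Function.comp_def] using this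
  have h2 : encodeGraph G'.1 = encodeGraph H'.1 := by
    have := congrArg (List.filterMap Sum.getRight?) h
    simpa [encodeDAGPair, List.filterMap_append, List.filterMap_map, Function.comp_def] using this
  have h3 : (⟨n, G⟩ : Σ n, DAG n) = ⟨m, H⟩ := encodeDAG_injective h1
  have h4 : (⟨n, G'⟩ : Σ n, DAG n) = ⟨m, H'⟩ := encodeDAG_injective h2
  cases h3
  cases h4
  rfl

/-- The decision problem `P`, with instances `a : α` given as the words `enc a`, is decidable in
polynomial time: one multi-stack Turing machine, with finite alphabets, computes the truth value
of `P a` from `enc a` within a number of steps polynomial in the length of `enc a`. -/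
def DecidableInPolyTime {α Γ : Type} (enc : α → List Γ) (P : α → Prop) : Prop :=
  ∃ f : α → Bool, (∀ a, f a = true ↔ P a) ∧
    ∃ T : Turing.TM2ComputableInPolyTime enc Computability.encodeBool f,
      ∀ k, Finite (T.tm.Γ k)

/-!
Two DAGs are model equivalent if and only if they have the same skeleton and every edge on which
they differ joins twins, that is, vertices with the same closed neighbourhood in the skeleton, and
has two shielded ends.

Sufficiency. Such edges can be reversed one at a time, beginning with one that has no vertex between
its ends. If `M` solves the Lyapunov equation for the covariance `S` and `K * S` is skew-symmetric,
then `M + K` is also a solution, and it is stable because `S` and `C` are positive definite. To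
reverse `i → j`, take `K = t (S u wᵀ - S w uᵀ)`, where `u` and `w` are regression vectors on `j` and
the parents of `i`. The hypotheses make the vertices outside this set that are not children of `i`
uncorrelated with it, so that `K` moves the entry of `i → j` to `j → i` and destroys no other zero.

Necessity. A violated condition is visible on at most four vertices. There an explicit integral
covariance matrix in the model of the first graph is excluded from that of the second by a
symmetric matrix paired with the Lyapunov equation in the trace form, and it extends to the whole
graph.

In particular a DAG is structurally identifiable if and only if it has no reversible edge. Both
criteria are first-order properties in a bounded number of vertices, so a multi-stack machine
evaluates them in polynomial time by loops over the vertices with unary counters.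
-/

/-- The continuous Lyapunov equation with drift `M`, covariance `S` and volatility `C`. -/
def LyapunovEq {V : Type*} [Fintype V] (M S C : Matrix V V ℝ) : Prop :=
  M * S + S * Mᵀ + C = 0

theorem isSymm_of_posDef {V : Type*} {S : Matrix V V ℝ} (hS : S.PosDef) : S.IsSymm :=
  Matrix.isHermitian_iff_isSymm.1 hS.isHermitian

theorem dotProduct_mulVec_comm_of_isSymm {V R : Type*} [Fintype V] [CommSemiring R]
    {S : Matrix V V R} (hS : S.IsSymm) (x y : V → R) : x ⬝ᵥ S *ᵥ y = y ⬝ᵥ S *ᵥ x := by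
  rw [Matrix.dotProduct_mulVec, ← Matrix.mulVec_transpose, hS.eq, dotProduct_comm]

namespace LyapunovEq

variable {V : Type*} [Fintype V] {M S C : Matrix V V ℝ}

theorem two_mul_dotProduct (h : LyapunovEq M S C) (hS : S.IsSymm) (x : V → ℝ) :
    2 * ((x ᵥ* M) ⬝ᵥ (S *ᵥ x)) = -(x ⬝ᵥ C *ᵥ x) := by
  have drift : x ⬝ᵥ (M * S) *ᵥ x = (x ᵥ* M) ⬝ᵥ (S *ᵥ x) := by
    rw [← Matrix.mulVec_mulVec, Matrix.dotProduct_mulVec]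
  have drift' : x ⬝ᵥ (S * Mᵀ) *ᵥ x = (x ᵥ* M) ⬝ᵥ (S *ᵥ x) := by
    rw [← Matrix.mulVec_mulVec, dotProduct_mulVec_comm_of_isSymm hS, Matrix.mulVec_transpose,
      dotProduct_mulVec_comm_of_isSymm hS, dotProduct_mulVec_comm_of_isSymm hS]
  have total : x ⬝ᵥ (M * S + S * Mᵀ + C) *ᵥ x = 0 := by rw [h, Matrix.zero_mulVec, dotProduct_zero]
  rw [Matrix.add_mulVec, Matrix.add_mulVec, dotProduct_add, dotProduct_add, drift, drift'] at total
  linarith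

/-- The added matrix `K` is such that `K * S` is skew-symmetric. -/
theorem add_smul_vecMulVec_sub (h : LyapunovEq M S C) (hS : S.IsSymm) (t : ℝ) (u w : V → ℝ) :
    LyapunovEq (M + t • (Matrix.vecMulVec (S *ᵥ u) w - Matrix.vecMulVec (S *ᵥ w) u)) S C := by
  have mul_right (v z : V → ℝ) : Matrix.vecMulVec v z * S = Matrix.vecMulVec v (S *ᵥ z) := by
    rw [Matrix.vecMulVec_mul, ← Matrix.mulVec_transpose, hS.eq]
  have mul_left (v z : V → ℝ) : S * (Matrix.vecMulVec v z)ᵀ = Matrix.vecMulVec (S *ᵥ z) v := by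
    rw [Matrix.transpose_vecMulVec, Matrix.mul_vecMulVec]
  rw [LyapunovEq, add_mul, Matrix.transpose_add, mul_add, Matrix.smul_mul, Matrix.transpose_smul,
    Matrix.mul_smul, sub_mul, Matrix.transpose_sub, mul_sub, mul_right, mul_right, mul_left,
    mul_left, ← h]
  module

end LyapunovEq

section Stability

variable {V : Type} [Fintype V] {M S C : Matrix V V ℝ}

theorem add_dotProduct_mulVec_pos (hS : S.PosDef) {x y : V → ℝ} (h : x ≠ 0 ∨ y ≠ 0) :
    0 < x ⬝ᵥ S *ᵥ x + y ⬝ᵥ S *ᵥ y := by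
  rcases h with h | h
  · exact add_pos_of_pos_of_nonneg (hS.dotProduct_mulVec_pos h)
      (hS.posSemidef.dotProduct_mulVec_nonneg y)
  · exact add_pos_of_nonneg_of_pos (hS.posSemidef.dotProduct_mulVec_nonneg x)
      (hS.dotProduct_mulVec_pos h)

variable [DecidableEq V]

theorem exists_re_im_vecMul_of_mem_spectrum {z : ℂ}
    (hz : z ∈ spectrum ℂ (M.map fun x : ℝ => (x : ℂ))) :
    ∃ x y : V → ℝ, (x ≠ 0 ∨ y ≠ 0) ∧
      x ᵥ* M = z.re • x - z.im • y ∧ y ᵥ* M = z.re • y + z.im • x := by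
  rw [spectrum.mem_iff, Matrix.isUnit_iff_isUnit_det, isUnit_iff_ne_zero, not_not,
    ← Matrix.exists_vecMul_eq_zero_iff] at hz
  obtain ⟨v, hv0, hv⟩ := hz
  have eigen : v ᵥ* M.map (fun x : ℝ => (x : ℂ)) = z • v := by
    rw [Matrix.vecMul_sub, sub_eq_zero] at hv
    rw [← hv, Algebra.algebraMap_eq_smul_one, Matrix.vecMul_smul, Matrix.vecMul_one]
  refine ⟨fun i => (v i).re, fun i => (v i).im, ?_, ?_, ?_⟩
  · by_contra! h
    exact hv0 (funext fun i => Complex.ext (congrFun h.1 i) (congrFun h.2 i))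
  · ext i
    simpa [Matrix.vecMul, dotProduct] using congrArg Complex.re (congrFun eigen i)
  · ext i
    simpa [Matrix.vecMul, dotProduct] using congrArg Complex.im (congrFun eigen i)

theorem LyapunovEq.isStableMatrix (h : LyapunovEq M S C) (hS : S.PosDef) (hC : C.PosDef) :
    IsStableMatrix M := by
  intro z hz
  obtain ⟨x, y, hne, hx, hy⟩ := exists_re_im_vecMul_of_mem_spectrum hz
  have hSymm := isSymm_of_posDef hS
  have quadratic :
      2 * z.re * (x ⬝ᵥ S *ᵥ x + y ⬝ᵥ S *ᵥ y) = -(x ⬝ᵥ C *ᵥ x + y ⬝ᵥ C *ᵥ y) := by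
    have qx := h.two_mul_dotProduct hSymm x
    have qy := h.two_mul_dotProduct hSymm y
    rw [hx, sub_dotProduct, smul_dotProduct, smul_dotProduct, smul_eq_mul, smul_eq_mul,
      dotProduct_mulVec_comm_of_isSymm hSymm y x] at qx
    rw [hy, add_dotProduct, smul_dotProduct, smul_dotProduct, smul_eq_mul, smul_eq_mul] at qy
    linarith
  have hSpos := add_dotProduct_mulVec_pos hS hne
  have hCpos := add_dotProduct_mulVec_pos hC hne
  by_contra! hre
  nlinarith [mul_nonneg hre hSpos.le]

theorem mem_lyapunovModel_iff {G : LoopedDigraph V} (hC : C.PosDef) :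
    S ∈ lyapunovModel G C ↔
      S.PosDef ∧ ∃ M : Matrix V V ℝ, IsSparseMatrix G M ∧ LyapunovEq M S C :=
  ⟨fun ⟨hS, M, _, h⟩ => ⟨hS, M, h⟩,
    fun ⟨hS, M, hM, h⟩ => ⟨hS, M, LyapunovEq.isStableMatrix h hS hC, hM, h⟩⟩

end Stability

/-- `u` is the column at `i` of the inverse of the submatrix of `S` on `A`, extended by `0`. It
isolates the `i`-th row of a drift matrix in the Lyapunov equation. -/
structure IsRegressionVector {V : Type*} [Fintype V] [DecidableEq V] (S : Matrix V V ℝ)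
    (A : Set V) (i : V) (u : V → ℝ) : Prop where
  eq_zero : ∀ k ∉ A, u k = 0
  mulVec_eq : ∀ k ∈ A, (S *ᵥ u) k = if k = i then 1 else 0

section Regression

variable {V : Type*} [Fintype V] [DecidableEq V] {S : Matrix V V ℝ} {A : Set V} {i : V}
  {u : V → ℝ}

theorem exists_isRegressionVector (hS : S.PosDef) (hi : i ∈ A) :
    ∃ u, IsRegressionVector S A i u := by
  classical
  let T : Matrix A A ℝ := S.submatrix (↑) (↑)
  have hT : T.PosDef := hS.submatrix Subtype.val_injective
  let w : A → ℝ := T⁻¹ *ᵥ Pi.single ⟨i, hi⟩ 1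
  let u : V → ℝ := fun k => if h : k ∈ A then w ⟨k, h⟩ else 0
  refine ⟨u, fun k hk => dif_neg hk, fun k hk => ?_⟩
  have restrict : (S *ᵥ u) k = (T *ᵥ w) ⟨k, hk⟩ := by
    rw [Matrix.mulVec, dotProduct, ← Finset.sum_subset (Finset.subset_univ {a | a ∈ A}),
      Finset.sum_subtype (p := (· ∈ A)) _ (by simp)]
    · exact Finset.sum_congr rfl fun a _ => by simp [u, T]
    · intro a _ ha
      simp [u, show a ∉ A by simpa using ha]
  rw [restrict, Matrix.mulVec_mulVec, Matrix.mul_nonsing_inv _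
    ((Matrix.isUnit_iff_isUnit_det _).1 hT.isUnit), Matrix.one_mulVec, Pi.single_apply]
  simp [Subtype.ext_iff]

namespace IsRegressionVector

theorem dotProduct_eq (h : IsRegressionVector S A i u) (hi : i ∈ A) {v : V → ℝ}
    (hv : ∀ k ∉ A, v k = 0) : v ⬝ᵥ (S *ᵥ u) = v i := by
  rw [dotProduct, Finset.sum_eq_single i, h.mulVec_eq i hi, if_pos rfl, mul_one]
  · intro k _ hk
    by_cases hkA : k ∈ A
    · rw [h.mulVec_eq k hkA, if_neg hk, mul_zero]
    · rw [hv k hkA, zero_mul]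
  · simp

theorem ne_zero (h : IsRegressionVector S A i u) (hi : i ∈ A) : u ≠ 0 := by
  rintro rfl
  simpa using h.mulVec_eq i hi

theorem pos (h : IsRegressionVector S A i u) (hS : S.PosDef) (hi : i ∈ A) : 0 < u i := by
  rw [← h.dotProduct_eq hi h.eq_zero]
  exact hS.dotProduct_mulVec_pos (h.ne_zero hi)

theorem vecMul_neg (h : IsRegressionVector S A i u) (hS : S.PosDef) (hi : i ∈ A)
    {M C : Matrix V V ℝ} (hC : C.PosDef) (hM : LyapunovEq M S C)
    (hA : ∀ k ∉ A, (u ᵥ* M) k = 0) : (u ᵥ* M) i < 0 := by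
  have quadratic := hM.two_mul_dotProduct (isSymm_of_posDef hS) u
  rw [h.dotProduct_eq hi hA] at quadratic
  have : 0 < u ⬝ᵥ C *ᵥ u := hC.dotProduct_mulVec_pos (h.ne_zero hi)
  linarith

theorem mulVec_eq_zero (h : IsRegressionVector S A i u) {r : V} (hri : r ≠ i)
    (hr : r ∉ A → ∀ k ∈ A, S r k = 0) : (S *ᵥ u) r = 0 := by
  by_cases hrA : r ∈ A
  · rw [h.mulVec_eq r hrA, if_neg hri]
  · refine Finset.sum_eq_zero fun k _ => ?_
    change S r k * u k = 0
    by_cases hkA : k ∈ A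
    · rw [hr hrA k hkA, zero_mul]
    · rw [h.eq_zero k hkA, mul_zero]

end IsRegressionVector

end Regression

namespace LoopedDigraph

variable {V : Type} {G : LoopedDigraph V}

theorem IsAcyclic.antisymm (hG : G.IsAcyclic) {a b : V} (hab : G.Adj a b) (hba : G.Adj b a) :
    a = b := by
  by_contra hne
  exact hG a (.tail (.single ⟨hne, hab⟩) ⟨Ne.symm hne, hba⟩)

theorem IsAcyclic.eq_of_triangle (hG : G.IsAcyclic) {a b c : V} (hab : G.Adj a b)
    (hbc : G.Adj b c) (hca : G.Adj c a) : a = b ∧ b = c := by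
  rcases eq_or_ne a b with rfl | nab
  · exact ⟨rfl, hG.antisymm hbc hca⟩
  rcases eq_or_ne b c with rfl | nbc
  · exact ⟨hG.antisymm hab hca, rfl⟩
  rcases eq_or_ne c a with rfl | nca
  · exact absurd (hG.antisymm hab hbc) nab
  exact absurd (.tail (.tail (.single ⟨nab, hab⟩) ⟨nbc, hbc⟩) ⟨nca, hca⟩) (hG a)

/-- `a` is a proper ancestor of `b`. -/
def Before (G : LoopedDigraph V) (a b : V) : Prop :=
  Relation.TransGen (fun a b => a ≠ b ∧ G.Adj a b) a b

theorem IsAcyclic.wellFounded_before [Finite V] (hG : G.IsAcyclic) : WellFounded G.Before := by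
  have : IsTrans V G.Before := ⟨fun _ _ _ => Relation.TransGen.trans⟩
  have : Std.Irrefl G.Before := ⟨hG⟩
  exact Finite.wellFounded_of_trans_of_irrefl _

/-- A set of vertices that contains the parents of its elements. -/
def IsAncestral (G : LoopedDigraph V) (A : Set V) : Prop :=
  ∀ a ∈ A, ∀ p, G.Adj p a → p ∈ A

theorem isAncestral_setOf_eq_or_before (G : LoopedDigraph V) (a : V) :
    G.IsAncestral {k | k = a ∨ G.Before k a} := by
  rintro k hk p hp
  rcases eq_or_ne p k with rfl | hpk
  · exact hk
  rcases hk with rfl | hk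
  · exact Or.inr (.single ⟨hpk, hp⟩)
  · exact Or.inr (.head ⟨hpk, hp⟩ hk)

/-- The graph on `U` whose edges are the pairs that `f` maps to edges of `G`. -/
def comap {U : Type} (f : U → V) (G : LoopedDigraph V) : LoopedDigraph U where
  Adj a b := G.Adj (f a) (f b)
  loop _ := G.loop _

theorem IsAcyclic.comap {U : Type} {f : U → V} (hG : G.IsAcyclic) (hf : f.Injective) :
    (G.comap f).IsAcyclic :=
  fun i h => hG (f i) (h.lift f fun _ _ hab => ⟨hf.ne hab.1, hab.2⟩)

end LoopedDigraph

section Covariance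

open LoopedDigraph

variable {V : Type} [Fintype V] {G : LoopedDigraph V} {M S : Matrix V V ℝ}

theorem IsSparseMatrix.vecMul_eq_zero (hM : IsSparseMatrix G M) {A : Set V}
    (hA : G.IsAncestral A) {u : V → ℝ} (hu : ∀ k ∉ A, u k = 0) {k : V} (hk : k ∉ A) :
    (u ᵥ* M) k = 0 := by
  refine Finset.sum_eq_zero fun r _ => ?_
  change u r * M r k = 0
  by_cases hr : r ∈ A
  · rw [hM k r fun hkr => hk (hA r hr k hkr), mul_zero]
  · rw [hu r hr, zero_mul]

variable [DecidableEq V] {c : V → ℝ}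

theorem LyapunovEq.diag_neg (h : LyapunovEq M S (Matrix.diagonal c)) (hG : G.IsAcyclic)
    (hS : S.PosDef) (hc : ∀ i, 0 < c i) (hM : IsSparseMatrix G M) (a : V) : M a a < 0 := by
  have ha : a ∈ {k | k = a ∨ G.Before k a} := Or.inl rfl
  obtain ⟨u, hu⟩ := exists_isRegressionVector hS ha
  have sink : (u ᵥ* M) a = u a * M a a := by
    rw [Matrix.vecMul, dotProduct, Finset.sum_eq_single a _ (by simp)]
    intro r _ hr
    by_cases hrA : r = a ∨ G.Before r a
    · rw [hM a r fun har => hG a (.head ⟨hr.symm, har⟩ (hrA.resolve_left hr)), mul_zero]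
    · rw [hu.eq_zero r hrA, zero_mul]
  have neg := hu.vecMul_neg hS ha (Matrix.PosDef.diagonal hc) h fun k =>
    hM.vecMul_eq_zero (G.isAncestral_setOf_eq_or_before a) hu.eq_zero
  rw [sink] at neg
  exact neg_of_mul_neg_right neg (hu.pos hS ha).le

theorem LyapunovEq.cov_eq_zero_of_isAncestral (h : LyapunovEq M S (Matrix.diagonal c))
    (hG : G.IsAcyclic) (hS : S.PosDef) (hc : ∀ i, 0 < c i) (hM : IsSparseMatrix G M)
    {A W : Set V} (hA : G.IsAncestral A) (hW : G.IsAncestral W) (hAW : Disjoint A W) :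
    ∀ a ∈ A, ∀ w ∈ W, S a w = 0 := by
  intro a
  induction a using hG.wellFounded_before.induction with
  | _ a iha =>
  intro ha w
  induction w using hG.wellFounded_before.induction with
  | _ w ihw =>
  intro hw
  have entry := congrFun (congrFun h a) w
  simp only [Matrix.add_apply, Matrix.mul_apply, Matrix.transpose_apply,
    Matrix.diagonal_apply_ne _ (hAW.ne_of_mem ha hw), Matrix.zero_apply, add_zero] at entry
  rw [Finset.sum_eq_single a, Finset.sum_eq_single w] at entry
  · have factored : (M a a + M w w) * S a w = 0 := by linarith
    exact (mul_eq_zero.1 factored).resolve_left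
      (add_neg (h.diag_neg hG hS hc hM a) (h.diag_neg hG hS hc hM w)).ne
  · intro k _ hk
    by_cases hkw : G.Adj k w
    · rw [ihw k (.single ⟨hk, hkw⟩) (hW w hw k hkw), zero_mul]
    · rw [hM k w hkw, mul_zero]
  · simp
  · intro k _ hk
    by_cases hka : G.Adj k a
    · rw [iha k (.single ⟨hk, hka⟩) (hA a ha k hka) w hw, mul_zero]
    · rw [hM k a hka, zero_mul]
  · simp

end Covariance

namespace LoopedDigraph

variable {V : Type} {G H : LoopedDigraph V} {i j k : V}

/-- `a` and `b` are equal or joined by an edge. -/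
def Linked (G : LoopedDigraph V) (a b : V) : Prop :=
  G.Adj a b ∨ G.Adj b a

theorem Linked.symm {a b : V} (h : G.Linked a b) : G.Linked b a :=
  Or.symm h

/-- `i` and `j` have the same closed neighbourhood in the skeleton of `G`. -/
def Twins (G : LoopedDigraph V) (i j : V) : Prop :=
  ∀ k, G.Linked i k ↔ G.Linked j k

/-- Every path of length two in the skeleton with `i` as an end or in the middle has adjacent
ends, except for colliders with `i` as an end and for two edges that both point to `i` or both
point away from `i`. -/
structure Shielded (G : LoopedDigraph V) (i : V) : Prop where
  grandparent : ∀ {a b}, G.Adj b a → G.Adj a i → G.Linked b i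
  grandchild : ∀ {a b}, G.Adj i a → G.Adj a b → G.Linked b i
  sibling : ∀ {a b}, G.Adj a i → G.Adj a b → G.Linked b i
  parent_child : ∀ {a b}, G.Adj a i → G.Adj i b → G.Linked a b

/-- The edge `i → j` can be reversed without changing the Lyapunov model. -/
structure Reversible (G : LoopedDigraph V) (i j : V) : Prop where
  ne : i ≠ j
  adj : G.Adj i j
  parent : ∀ {k}, k ≠ i → k ≠ j → (G.Adj k i ↔ G.Adj k j)
  child : ∀ {k}, k ≠ i → k ≠ j → (G.Adj i k ↔ G.Adj j k)
  shielded_left : G.Shielded i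
  shielded_right : G.Shielded j

theorem Shielded.comap {U : Type} {f : U → V} {x : U} (h : G.Shielded (f x)) :
    (G.comap f).Shielded x where
  grandparent := h.grandparent
  grandchild := h.grandchild
  sibling := h.sibling
  parent_child := h.parent_child

section Swap

variable [DecidableEq V]

/-- The graph in which `i` and `j` exchange their roles. For a reversible edge `i → j` this is
the graph obtained by reversing that edge. -/
def swap (G : LoopedDigraph V) (i j : V) : LoopedDigraph V :=
  G.comap (Equiv.swap i j)

theorem swap_comm (G : LoopedDigraph V) (i j : V) : G.swap i j = G.swap j i := by
  rw [swap, swap, Equiv.swap_comm]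

theorem swap_swap (G : LoopedDigraph V) (i j : V) : (G.swap i j).swap i j = G := by
  ext a b
  simp [swap, comap]

theorem swap_adj_left (G : LoopedDigraph V) (i j : V) : (G.swap i j).Adj i j ↔ G.Adj j i := by
  simp [swap, comap]

theorem swap_adj_right (G : LoopedDigraph V) (i j : V) : (G.swap i j).Adj j i ↔ G.Adj i j := by
  simp [swap, comap]

theorem IsAcyclic.swap (hG : G.IsAcyclic) (i j : V) : (G.swap i j).IsAcyclic :=
  hG.comap (Equiv.swap i j).injective

namespace Reversible

theorem swap (h : G.Reversible i j) : (G.swap i j).Reversible j i where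
  ne := h.ne.symm
  adj := (G.swap_adj_right i j).2 h.adj
  parent hj hi := by
    simpa [LoopedDigraph.swap, LoopedDigraph.comap, Equiv.swap_apply_of_ne_of_ne hi hj] using
      h.parent hi hj
  child hj hi := by
    simpa [LoopedDigraph.swap, LoopedDigraph.comap, Equiv.swap_apply_of_ne_of_ne hi hj] using
      h.child hi hj
  shielded_left := Shielded.comap (by simpa using h.shielded_left)
  shielded_right := Shielded.comap (by simpa using h.shielded_right)

theorem shielded_swap (h : G.Reversible i j) {x : V} (hx : G.Shielded x) :
    (G.swap i j).Shielded x := by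
  refine Shielded.comap ?_
  rw [Equiv.swap_apply_def]
  split_ifs
  · exact h.shielded_right
  · exact h.shielded_left
  · exact hx

theorem swap_adj_iff (h : G.Reversible i j) {a b : V} (hij : ¬ (a = i ∧ b = j))
    (hji : ¬ (a = j ∧ b = i)) : (G.swap i j).Adj a b ↔ G.Adj a b := by
  have hp := @h.parent
  have hc := @h.child
  have := h.ne
  have hl := G.loop
  simp only [LoopedDigraph.swap, LoopedDigraph.comap, Equiv.swap_apply_def]
  by_cases hai : a = i <;> by_cases haj : a = j <;> by_cases hbi : b = i <;>
    by_cases hbj : b = j <;> simp_all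

theorem swap_linked_iff (h : G.Reversible i j) {a b : V} :
    (G.swap i j).Linked a b ↔ G.Linked a b := by
  by_cases hij : a = i ∧ b = j
  · obtain ⟨rfl, rfl⟩ := hij
    rw [Linked, Linked, swap_adj_left, swap_adj_right, or_comm]
  by_cases hji : a = j ∧ b = i
  · obtain ⟨rfl, rfl⟩ := hji
    rw [Linked, Linked, swap_adj_left, swap_adj_right, or_comm]
  · rw [Linked, Linked, h.swap_adj_iff hij hji,
      h.swap_adj_iff (fun e => hji e.symm) (fun e => hij e.symm)]

end Reversible

end Swap

/-- The parents of `i`, including `i` itself, together with `j`. -/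
def reversalBase (G : LoopedDigraph V) (i j : V) : Set V :=
  {k | G.Adj k i ∨ k = j}

/-- The vertices outside `reversalBase` that are not children of `i`. -/
def reversalRest (G : LoopedDigraph V) (i j : V) : Set V :=
  {k | k ∉ G.reversalBase i j ∧ ¬ G.Adj i k}

namespace Reversible

theorem isAncestral_reversalBase (h : G.Reversible i j) (hG : G.IsAcyclic) :
    G.IsAncestral (G.reversalBase i j) := by
  rintro a (ha | rfl) p hp
  · rcases h.shielded_left.grandparent hp ha with hl | hl
    · exact Or.inl hl
    · obtain ⟨rfl, rfl⟩ := hG.eq_of_triangle hl hp ha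
      exact Or.inl (G.loop _)
  · rcases eq_or_ne p i with rfl | hpi
    · exact Or.inl (G.loop _)
    rcases eq_or_ne p a with rfl | hpa
    · exact Or.inr rfl
    exact Or.inl ((h.parent hpi hpa).2 hp)

theorem isAncestral_reversalRest (h : G.Reversible i j) :
    G.IsAncestral (G.reversalRest i j) := by
  rintro w ⟨hwA, hiw⟩ p hp
  have hwi : ¬ G.Adj w i := fun e => hwA (Or.inl e)
  have hwj : w ≠ j := fun e => hwA (Or.inr e)
  have not_linked : ¬ G.Linked w i := fun e => e.elim hwi hiw
  refine ⟨?_, fun hip => not_linked (h.shielded_left.grandchild hip hp)⟩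
  rintro (hpi | rfl)
  · exact not_linked (h.shielded_left.sibling hpi hp)
  · exact hiw ((h.child (fun e => hiw (e ▸ G.loop _)) hwj).2 hp)

theorem ne_of_not_swap_adj [DecidableEq V] (h : G.Reversible i j) (hG : G.IsAcyclic) {a r : V}
    (ha : a ∈ G.reversalBase i j) (har : ¬ (G.swap i j).Adj a r) (hij : ¬ (a = i ∧ r = j)) :
    r ≠ i ∧ r ≠ j ∧ ¬ G.Adj i r := by
  have hji : ¬ (a = j ∧ r = i) := by
    rintro ⟨rfl, rfl⟩
    exact har ((G.swap_adj_right _ _).2 h.adj)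
  rw [h.swap_adj_iff hij hji] at har
  have hri : r ≠ i := by
    rintro rfl
    exact ha.elim har fun e => hji ⟨e, rfl⟩
  have hrj : r ≠ j := by
    rintro rfl
    rcases ha with ha | rfl
    · exact har ((h.parent (fun e => hij ⟨e, rfl⟩) fun e => har (e ▸ G.loop _)).1 ha)
    · exact har (G.loop _)
  refine ⟨hri, hrj, fun hir => ?_⟩
  rcases ha with ha | rfl
  · rcases h.shielded_left.parent_child ha hir with hl | hl
    · exact har hl
    · obtain ⟨rfl, rfl⟩ := hG.eq_of_triangle hl ha hir
      exact har (G.loop _)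
  · exact har ((h.child hri hrj).1 hir)

end Reversible

end LoopedDigraph

section Reversal

open LoopedDigraph

variable {V : Type} [Fintype V] [DecidableEq V] {G : LoopedDigraph V} {i j : V}

theorem LoopedDigraph.Reversible.isSparseMatrix_swap (h : G.Reversible i j) (hG : G.IsAcyclic)
    {M S : Matrix V V ℝ} (hM : IsSparseMatrix G M) {u w : V → ℝ}
    (hu : IsRegressionVector S (G.reversalBase i j) i u)
    (hw : IsRegressionVector S (G.reversalBase i j) j w) (hui : u i ≠ 0)
    (hcov : ∀ r ∈ G.reversalRest i j, ∀ a ∈ G.reversalBase i j, S r a = 0) :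
    IsSparseMatrix (G.swap i j)
      (M + (M j i / u i) • (Matrix.vecMulVec (S *ᵥ u) w - Matrix.vecMulVec (S *ᵥ w) u)) := by
  intro a r har
  simp only [Matrix.add_apply, Matrix.smul_apply, Matrix.sub_apply, Matrix.vecMulVec_apply,
    smul_eq_mul]
  by_cases hij : a = i ∧ r = j
  · obtain ⟨rfl, rfl⟩ := hij
    rw [hu.mulVec_eq _ (Or.inr rfl), hw.mulVec_eq _ (Or.inr rfl), if_neg h.ne.symm, if_pos rfl]
    field_simp
    ring
  have hji : ¬ (a = j ∧ r = i) := by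
    rintro ⟨rfl, rfl⟩
    exact har ((G.swap_adj_right _ _).2 h.adj)
  rw [hM a r (mt (h.swap_adj_iff hij hji).2 har)]
  by_cases ha : a ∈ G.reversalBase i j
  · obtain ⟨hri, hrj, hir⟩ := h.ne_of_not_swap_adj hG ha har hij
    rw [hu.mulVec_eq_zero hri fun hr => hcov r ⟨hr, hir⟩,
      hw.mulVec_eq_zero hrj fun hr => hcov r ⟨hr, hir⟩]
    ring
  · rw [hu.eq_zero a ha, hw.eq_zero a ha]
    ring

variable {c : V → ℝ}

theorem lyapunovModel_subset_swap (hc : ∀ k, 0 < c k) (hG : G.IsAcyclic)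
    (h : G.Reversible i j) :
    lyapunovModel G (Matrix.diagonal c) ⊆ lyapunovModel (G.swap i j) (Matrix.diagonal c) := by
  intro S hSG
  rw [mem_lyapunovModel_iff (Matrix.PosDef.diagonal hc)] at hSG ⊢
  obtain ⟨hS, M, hM, hMS⟩ := hSG
  have hi : i ∈ G.reversalBase i j := Or.inl (G.loop i)
  obtain ⟨u, hu⟩ := exists_isRegressionVector hS hi
  obtain ⟨w, hw⟩ := exists_isRegressionVector (i := j) hS (A := G.reversalBase i j) (Or.inr rfl)
  have hcov := hMS.cov_eq_zero_of_isAncestral hG hS hc hM h.isAncestral_reversalRest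
    (h.isAncestral_reversalBase hG) (Set.disjoint_left.2 fun _ hr => hr.1)
  exact ⟨hS, _, h.isSparseMatrix_swap hG hM hu hw (hu.pos hS hi).ne' hcov,
    hMS.add_smul_vecMulVec_sub (isSymm_of_posDef hS) _ u w⟩

theorem lyapunovModel_swap (hc : ∀ k, 0 < c k) (hG : G.IsAcyclic) (h : G.Reversible i j) :
    lyapunovModel (G.swap i j) (Matrix.diagonal c) = lyapunovModel G (Matrix.diagonal c) := by
  refine Set.Subset.antisymm ?_ (lyapunovModel_subset_swap hc hG h)
  have back := lyapunovModel_subset_swap hc (hG.swap i j) h.swap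
  rwa [swap_comm _ j i, swap_swap] at back

end Reversal

namespace LoopedDigraph

variable {V : Type} {G H : LoopedDigraph V} {i j k : V}

/-- The edges of `G`, other than loops, whose reversal is an edge of `H`. -/
def reversedEdges (G H : LoopedDigraph V) : Set (V × V) :=
  {e | e.1 ≠ e.2 ∧ G.Adj e.1 e.2 ∧ H.Adj e.2 e.1}

/-- `G` and `H` have the same skeleton, and differ only by the direction of edges between
twins. -/
structure TwinReversal (G H : LoopedDigraph V) : Prop where
  linked : ∀ {a b}, G.Linked a b ↔ H.Linked a b
  twins : ∀ {i j}, (i, j) ∈ reversedEdges G H → G.Twins i j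

/-- The combinatorial criterion for model equivalence. -/
structure LocallyEquivalent (G H : LoopedDigraph V) : Prop extends TwinReversal G H where
  shielded : ∀ {i j}, (i, j) ∈ reversedEdges G H → G.Shielded i ∧ G.Shielded j

theorem TwinReversal.eq_of_reversedEdges_eq_empty (h : TwinReversal G H)
    (he : reversedEdges G H = ∅) : G = H := by
  have not_reversed {a b : V} (hab : a ≠ b) (hG : G.Adj a b) : ¬ H.Adj b a := fun hH =>
    (Set.ext_iff.1 he (a, b)).1 ⟨hab, hG, hH⟩
  ext a b
  rcases eq_or_ne a b with rfl | hab
  · exact iff_of_true (G.loop a) (H.loop a)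
  · exact ⟨fun hG => (h.linked.1 (Or.inl hG)).resolve_right (not_reversed hab hG),
      fun hH => (h.linked.2 (Or.inl hH)).resolve_right fun hG => not_reversed hab.symm hG hH⟩

/-- The inner vertices of the directed paths of length two from `i` to `j`. -/
def between (G : LoopedDigraph V) (i j : V) : Set V :=
  {k | k ≠ i ∧ k ≠ j ∧ G.Adj i k ∧ G.Adj k j}

namespace Twins

theorem between_left_ssubset (h : G.Twins i j) (hG : G.IsAcyclic) (hk : k ∈ G.between i j) :
    G.between i k ⊂ G.between i j := by
  refine (Set.ssubset_iff_of_subset ?_).2 ⟨k, hk, fun hkk => hkk.2.1 rfl⟩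
  obtain ⟨-, -, -, hkj⟩ := hk
  rintro m ⟨hmi, hmk, him, hmk'⟩
  refine ⟨hmi, ?_, him, ?_⟩
  · rintro rfl
    exact hmk (hG.antisymm hmk' hkj)
  · exact ((h m).1 (Or.inl him)).resolve_left fun hjm => hmk (hG.eq_of_triangle hjm hmk' hkj).2

theorem between_right_ssubset (h : G.Twins i j) (hG : G.IsAcyclic) (hk : k ∈ G.between i j) :
    G.between k j ⊂ G.between i j := by
  refine (Set.ssubset_iff_of_subset ?_).2 ⟨k, hk, fun hkk => hkk.1 rfl⟩
  obtain ⟨-, -, hik, -⟩ := hk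
  rintro m ⟨hmk, hmj, hkm, hmj'⟩
  have hmi : m ≠ i := by
    rintro rfl
    exact hmk (hG.antisymm hik hkm)
  exact ⟨hmi, hmj, ((h m).2 (Or.inr hmj')).resolve_right fun hmi' =>
    hmi (hG.eq_of_triangle hmi' hik hkm).1, hmj'⟩

theorem reversible (h : G.Twins i j) (hG : G.IsAcyclic) (hne : i ≠ j) (hij : G.Adj i j)
    (hb : G.between i j = ∅) (hi : G.Shielded i) (hj : G.Shielded j) : G.Reversible i j where
  ne := hne
  adj := hij
  parent {k} hki hkj :=
    ⟨fun hk => ((h k).1 (Or.inr hk)).resolve_left fun hjk =>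
        hki (hG.eq_of_triangle hk hij hjk).1,
      fun hk => ((h k).2 (Or.inr hk)).resolve_left fun hik =>
        Set.notMem_empty k (hb ▸ ⟨hki, hkj, hik, hk⟩)⟩
  child {k} hki hkj :=
    ⟨fun hk => ((h k).1 (Or.inl hk)).resolve_right fun hkj' =>
        Set.notMem_empty k (hb ▸ ⟨hki, hkj, hk, hkj'⟩),
      fun hk => ((h k).2 (Or.inl hk)).resolve_right fun hki' =>
        hkj (hG.eq_of_triangle hij hk hki').2.symm⟩
  shielded_left := hi
  shielded_right := hj

end Twins

theorem TwinReversal.exists_between_eq_empty [Finite V] (h : TwinReversal G H)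
    (hG : G.IsAcyclic) (hH : H.IsAcyclic) (he : (reversedEdges G H).Nonempty) :
    ∃ i j, (i, j) ∈ reversedEdges G H ∧ G.between i j = ∅ := by
  obtain ⟨⟨i, j⟩, hij, hmin⟩ := exists_minimalFor_of_wellFoundedLT (· ∈ reversedEdges G H)
    (fun e => G.between e.1 e.2) he
  refine ⟨i, j, hij, Set.eq_empty_iff_forall_notMem.2 fun k hk => ?_⟩
  have htw := h.twins hij
  obtain ⟨hki, hkj, hik, hkj'⟩ := id hk
  rcases h.linked.1 (Or.inl hik) with hik' | hki'
  · rcases h.linked.1 (Or.inl hkj') with hkj'' | hjk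
    · exact hki (hH.eq_of_triangle hij.2.2 hik' hkj'').2.symm
    · have smaller := htw.between_right_ssubset hG hk
      exact smaller.not_subset (@hmin (k, j) ⟨hkj, hkj', hjk⟩ smaller.subset)
  · have smaller := htw.between_left_ssubset hG hk
    exact smaller.not_subset (@hmin (i, k) ⟨hki.symm, hik, hki'⟩ smaller.subset)

namespace LocallyEquivalent

theorem exists_reversible [Finite V] (h : LocallyEquivalent G H) (hG : G.IsAcyclic)
    (hH : H.IsAcyclic) (he : (reversedEdges G H).Nonempty) :
    ∃ i j, G.Reversible i j ∧ H.Adj j i := by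
  obtain ⟨i, j, hij, hb⟩ := h.exists_between_eq_empty hG hH he
  obtain ⟨hi, hj⟩ := h.shielded hij
  exact ⟨i, j, (h.twins hij).reversible hG hij.1 hij.2.1 hb hi hj, hij.2.2⟩

theorem eq_of_forall_not_reversible [Finite V] (h : LocallyEquivalent G H) (hG : G.IsAcyclic)
    (hH : H.IsAcyclic) (hr : ∀ i j, ¬ G.Reversible i j) : G = H := by
  refine h.eq_of_reversedEdges_eq_empty (Set.not_nonempty_iff_eq_empty.1 fun he => ?_)
  obtain ⟨i, j, hij, -⟩ := h.exists_reversible hG hH he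
  exact hr i j hij

end LocallyEquivalent

section Swap

variable [DecidableEq V]

theorem Reversible.reversedEdges_swap_ssubset (h : G.Reversible i j) (hG : G.IsAcyclic)
    (hH : H.IsAcyclic) (hji : H.Adj j i) :
    reversedEdges (G.swap i j) H ⊂ reversedEdges G H := by
  refine (Set.ssubset_iff_of_subset ?_).2 ⟨(i, j), ⟨h.ne, h.adj, hji⟩, fun hs =>
    h.ne (hG.antisymm h.adj ((G.swap_adj_left i j).1 hs.2.1))⟩
  rintro ⟨a, b⟩ ⟨hab, hG', hH'⟩
  by_cases hij : a = i ∧ b = j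
  · obtain ⟨rfl, rfl⟩ := hij
    exact ⟨hab, h.adj, hH'⟩
  by_cases hji' : a = j ∧ b = i
  · obtain ⟨rfl, rfl⟩ := hji'
    exact absurd (hH.antisymm hji hH') hab
  · exact ⟨hab, (h.swap_adj_iff hij hji').1 hG', hH'⟩

theorem LocallyEquivalent.swap (h : LocallyEquivalent G H) (hr : G.Reversible i j)
    (hG : G.IsAcyclic) (hH : H.IsAcyclic) (hji : H.Adj j i) :
    LocallyEquivalent (G.swap i j) H where
  linked := hr.swap_linked_iff.trans h.linked
  twins hab k := by
    rw [hr.swap_linked_iff, hr.swap_linked_iff]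
    exact h.twins ((hr.reversedEdges_swap_ssubset hG hH hji).subset hab) k
  shielded hab := by
    obtain ⟨ha, hb⟩ := h.shielded ((hr.reversedEdges_swap_ssubset hG hH hji).subset hab)
    exact ⟨hr.shielded_swap ha, hr.shielded_swap hb⟩

theorem LocallyEquivalent.lyapunovModel_eq [Fintype V] {c : V → ℝ} (hc : ∀ k, 0 < c k)
    (hG : G.IsAcyclic) (hH : H.IsAcyclic) (h : LocallyEquivalent G H) :
    lyapunovModel G (Matrix.diagonal c) = lyapunovModel H (Matrix.diagonal c) := by
  induction hR : reversedEdges G H using WellFoundedLT.induction generalizing G with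
  | _ R ih =>
  rcases (reversedEdges G H).eq_empty_or_nonempty with he | he
  · rw [h.eq_of_reversedEdges_eq_empty he]
  · obtain ⟨i, j, hr, hji⟩ := h.exists_reversible hG hH he
    rw [← lyapunovModel_swap hc hG hr]
    exact ih _ (hR ▸ hr.reversedEdges_swap_ssubset hG hH hji) (hG.swap i j)
      (h.swap hr hG hH hji) rfl

end Swap

end LoopedDigraph

section Induced

variable {U V : Type*} [Fintype U] {E : Matrix V U ℝ} {R : Matrix U V ℝ} {Q : Matrix V V ℝ}
  {T : Matrix U U ℝ}

theorem posDef_mul_mul_transpose_add [Finite V] (hT : T.PosDef) (hQ : Q.PosSemidef)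
    (hC : (E * Eᵀ + Q).PosDef) : (E * T * Eᵀ + Q).PosDef := by
  classical
  cases nonempty_fintype V
  have quadratic (A : Matrix U U ℝ) (x : V → ℝ) :
      x ⬝ᵥ (E * A * Eᵀ + Q) *ᵥ x = (Eᵀ *ᵥ x) ⬝ᵥ A *ᵥ (Eᵀ *ᵥ x) + x ⬝ᵥ Q *ᵥ x := by
    rw [Matrix.add_mulVec, dotProduct_add, Matrix.mul_assoc, ← Matrix.mulVec_mulVec,
      ← Matrix.mulVec_mulVec, Matrix.dotProduct_mulVec, ← Matrix.mulVec_transpose]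
  refine Matrix.PosDef.of_dotProduct_mulVec_pos ?_ fun {x} hx => ?_
  · have hTE := hT.posSemidef.mul_mul_conjTranspose_same E
    rw [Matrix.conjTranspose_eq_transpose_of_trivial] at hTE
    exact hTE.isHermitian.add hQ.isHermitian
  · rw [star_trivial, quadratic]
    rcases eq_or_ne (Eᵀ *ᵥ x) 0 with h0 | h0
    · have hCx := hC.dotProduct_mulVec_pos hx
      have quadratic_one := quadratic 1 x
      rw [Matrix.mul_one] at quadratic_one
      rw [star_trivial, quadratic_one, h0, zero_dotProduct, zero_add] at hCx
      rwa [h0, zero_dotProduct, zero_add]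
    · exact add_pos_of_pos_of_nonneg (hT.dotProduct_mulVec_pos h0)
        (hQ.dotProduct_mulVec_nonneg x)

variable [DecidableEq U] [Fintype V]

theorem mul_mul_mul_transpose_add (hRE : R * E = 1) (hRQ : R * Q = 0) :
    R * (E * T * Eᵀ + Q) = T * Eᵀ := by
  rw [Matrix.mul_add, hRQ, add_zero, ← Matrix.mul_assoc, ← Matrix.mul_assoc, hRE, Matrix.one_mul]

theorem LyapunovEq.extend [DecidableEq V] {N : Matrix U U ℝ} (h : LyapunovEq N T 1)
    (hT : T.IsSymm) (hQ : Q.IsSymm) (hRE : R * E = 1) (hRQ : R * Q = 0) :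
    LyapunovEq (E * (N + (1 / 2 : ℝ) • 1) * R - (1 / 2 : ℝ) • 1) (E * T * Eᵀ + Q)
      (E * Eᵀ + Q) := by
  set S := E * T * Eᵀ + Q
  have hS : Sᵀ = S := by
    simp only [S, Matrix.transpose_add, Matrix.transpose_mul, Matrix.transpose_transpose, hT.eq,
      hQ.eq, Matrix.mul_assoc]
  have drift : (E * (N + (1 / 2 : ℝ) • 1) * R - (1 / 2 : ℝ) • 1) * S =
      E * (N * T) * Eᵀ - (1 / 2 : ℝ) • Q := by
    rw [Matrix.sub_mul, Matrix.mul_assoc _ R, mul_mul_mul_transpose_add hRE hRQ]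
    simp only [S, Matrix.mul_add, Matrix.add_mul, Matrix.smul_mul, Matrix.mul_smul, Matrix.one_mul,
      Matrix.mul_one, Matrix.mul_assoc]
    module
  have total : S * (E * (N + (1 / 2 : ℝ) • 1) * R - (1 / 2 : ℝ) • 1)ᵀ =
      E * (T * Nᵀ) * Eᵀ - (1 / 2 : ℝ) • Q := by
    conv_lhs => rw [← hS]
    rw [← Matrix.transpose_mul, drift]
    simp only [Matrix.transpose_sub, Matrix.transpose_smul, Matrix.transpose_mul,
      Matrix.transpose_transpose, hT.eq, hQ.eq, Matrix.mul_assoc]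
  have inner : N * T + T * Nᵀ = -1 := eq_neg_of_add_eq_zero_left h
  rw [LyapunovEq, drift, total]
  calc _ = E * (N * T + T * Nᵀ) * Eᵀ + E * Eᵀ := by rw [Matrix.mul_add, Matrix.add_mul]; module
    _ = 0 := by rw [inner, Matrix.mul_neg, Matrix.neg_mul, Matrix.mul_one, neg_add_cancel]

theorem LyapunovEq.restrict {M : Matrix V V ℝ}
    (h : LyapunovEq M (E * T * Eᵀ + Q) (E * Eᵀ + Q)) (hQ : Q.IsSymm) (hRE : R * E = 1)
    (hRQ : R * Q = 0) : LyapunovEq (R * M * E) T 1 := by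
  have hER : Eᵀ * Rᵀ = 1 := by rw [← Matrix.transpose_mul, hRE, Matrix.transpose_one]
  have hQR : Q * Rᵀ = 0 := by rw [← hQ.eq, ← Matrix.transpose_mul, hRQ, Matrix.transpose_zero]
  have drift : R * (M * (E * T * Eᵀ + Q)) * Rᵀ = R * M * E * T := by
    simp only [Matrix.mul_add, Matrix.add_mul, Matrix.mul_assoc, hER, hQR, Matrix.mul_zero,
      add_zero, Matrix.mul_one]
  have drift' : R * ((E * T * Eᵀ + Q) * Mᵀ) * Rᵀ = T * (R * M * E)ᵀ := by
    rw [← Matrix.mul_assoc, mul_mul_mul_transpose_add hRE hRQ]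
    simp only [Matrix.transpose_mul, Matrix.mul_assoc]
  have volatility : R * (E * Eᵀ + Q) * Rᵀ = 1 := by
    rw [Matrix.mul_add, hRQ, add_zero, ← Matrix.mul_assoc, hRE, Matrix.one_mul, hER]
  rw [LyapunovEq, ← drift, ← drift', ← volatility, ← Matrix.add_mul, ← Matrix.add_mul,
    ← Matrix.mul_add, ← Matrix.mul_add, h, Matrix.mul_zero, Matrix.zero_mul]

end Induced

section Sparse

variable {U V : Type} {G : LoopedDigraph V}

theorem IsSparseMatrix.mul_mul [Fintype U] {F : LoopedDigraph U} {K : Matrix U U ℝ}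
    {E : Matrix V U ℝ} {R : Matrix U V ℝ} (hK : IsSparseMatrix F K)
    (h : ∀ {x y a b}, R x a ≠ 0 → E b y ≠ 0 → F.Adj x y → G.Adj a b) :
    IsSparseMatrix G (E * K * R) := by
  intro a b hab
  simp only [Matrix.mul_apply, Finset.sum_mul]
  refine Finset.sum_eq_zero fun x _ => Finset.sum_eq_zero fun y _ => ?_
  by_contra! hne
  exact hab (h (right_ne_zero_of_mul hne) (left_ne_zero_of_mul (left_ne_zero_of_mul hne))
    (not_not.1 fun hxy => right_ne_zero_of_mul (left_ne_zero_of_mul hne) (hK x y hxy)))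

theorem IsSparseMatrix.add_smul_one [DecidableEq V] {M : Matrix V V ℝ} (hM : IsSparseMatrix G M)
    (t : ℝ) : IsSparseMatrix G (M + t • 1) := by
  intro a b hab
  have hne : b ≠ a := by
    rintro rfl
    exact hab (G.loop _)
  rw [Matrix.add_apply, hM a b hab, Matrix.smul_apply, Matrix.one_apply_ne hne, smul_zero, add_zero]

end Sparse

section Marginal

variable {U V : Type} [DecidableEq V] {c : V → ℝ} {f : U → V}

/-- The inclusion of `ℝ^U` into `ℝ^V` along `f`, rescaled so that it turns the identity volatility
matrix into the restriction of `Matrix.diagonal c` to the range of `f`. -/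
noncomputable def scaledInclusion (c : V → ℝ) (f : U → V) : Matrix V U ℝ :=
  .of fun a x => if a = f x then √(c a) else 0

/-- The left inverse of `scaledInclusion c f` that forgets the coordinates off the range of `f`. -/
noncomputable def scaledProjection (c : V → ℝ) (f : U → V) : Matrix U V ℝ :=
  .of fun x a => if a = f x then (√(c a))⁻¹ else 0

open scoped Classical in
/-- The part of `Matrix.diagonal c` that lives off the range of `f`. -/
noncomputable def offRangeDiagonal (c : V → ℝ) (f : U → V) : Matrix V V ℝ :=
  Matrix.diagonal fun a => if a ∈ Set.range f then 0 else c a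

theorem posSemidef_offRangeDiagonal (hc : ∀ k, 0 < c k) : (offRangeDiagonal c f).PosSemidef := by
  classical
  refine Matrix.PosSemidef.diagonal fun a => ?_
  dsimp only
  split_ifs
  exacts [le_rfl, (hc a).le]

theorem isSymm_offRangeDiagonal : (offRangeDiagonal c f).IsSymm :=
  Matrix.isSymm_diagonal _

theorem scaledInclusion_mul_transpose_add [Fintype U] (hc : ∀ k, 0 < c k) (hf : f.Injective) :
    scaledInclusion c f * (scaledInclusion c f)ᵀ + offRangeDiagonal c f = Matrix.diagonal c := by
  classical
  ext a b
  rw [Matrix.add_apply, Matrix.mul_apply, offRangeDiagonal]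
  simp only [Matrix.transpose_apply, scaledInclusion, Matrix.of_apply]
  by_cases ha : a ∈ Set.range f
  · obtain ⟨x, rfl⟩ := ha
    rcases eq_or_ne (f x) b with rfl | hb
    · simp [hf.eq_iff, Real.mul_self_sqrt (hc _).le]
    · rw [Matrix.diagonal_apply_ne _ hb, Matrix.diagonal_apply_ne _ hb, add_zero]
      refine Finset.sum_eq_zero fun y _ => ?_
      split_ifs with hx hy <;> simp_all
  · have hne (x : U) : a ≠ f x := fun e => ha ⟨x, e.symm⟩
    simp only [Matrix.diagonal_apply, if_neg ha, if_neg (hne _), zero_mul, Finset.sum_const_zero,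
      zero_add]

variable [Fintype V]

theorem scaledProjection_mul_scaledInclusion [DecidableEq U] (hc : ∀ k, 0 < c k)
    (hf : f.Injective) : scaledProjection c f * scaledInclusion c f = 1 := by
  ext x y
  have hs : √(c (f x)) ≠ 0 := (Real.sqrt_pos.2 (hc _)).ne'
  rw [Matrix.mul_apply]
  rcases eq_or_ne x y with rfl | hxy
  · simp [scaledProjection, scaledInclusion, hs]
  · simp [scaledProjection, scaledInclusion, hf.eq_iff, hxy, hxy.symm]

theorem scaledProjection_mul_offRangeDiagonal :
    scaledProjection c f * offRangeDiagonal c f = 0 := by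
  ext x a
  simp only [offRangeDiagonal, Matrix.mul_diagonal, scaledProjection, Matrix.of_apply,
    Matrix.zero_apply]
  split_ifs with h h' <;> simp_all

/-- Passing to an induced subgraph also normalises the volatility matrix to the identity. -/
theorem exists_isSparseMatrix_comap_of_lyapunovModel_subset [Fintype U] [DecidableEq U]
    {G H : LoopedDigraph V} {T N : Matrix U U ℝ} (hc : ∀ k, 0 < c k)
    (hsub : lyapunovModel G (Matrix.diagonal c) ⊆ lyapunovModel H (Matrix.diagonal c))
    (hf : f.Injective) (hT : T.PosDef) (hN : IsSparseMatrix (G.comap f) N)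
    (h : LyapunovEq N T 1) :
    ∃ N' : Matrix U U ℝ, IsSparseMatrix (H.comap f) N' ∧ LyapunovEq N' T 1 := by
  have hC : (Matrix.diagonal c).PosDef := Matrix.PosDef.diagonal hc
  have hdiag := scaledInclusion_mul_transpose_add hc hf
  have hRE := scaledProjection_mul_scaledInclusion hc hf
  have hRQ := scaledProjection_mul_offRangeDiagonal (c := c) (f := f)
  have range_of_ne_zero {x : U} {a : V} {t : ℝ} (hne : (if a = f x then t else 0) ≠ 0) :
      a = f x := not_not.1 fun ha => hne (if_neg ha)
  have hmem : scaledInclusion c f * T * (scaledInclusion c f)ᵀ + offRangeDiagonal c f ∈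
      lyapunovModel G (Matrix.diagonal c) := by
    refine (mem_lyapunovModel_iff hC).2 ⟨posDef_mul_mul_transpose_add hT
      (posSemidef_offRangeDiagonal hc) (hdiag.symm ▸ hC), _, ?_, hdiag ▸
      h.extend (isSymm_of_posDef hT) isSymm_offRangeDiagonal hRE hRQ⟩
    rw [sub_eq_add_neg, ← neg_smul]
    refine ((hN.add_smul_one _).mul_mul fun hx hy hxy => ?_).add_smul_one _
    rwa [range_of_ne_zero hx, range_of_ne_zero hy]
  obtain ⟨-, M, hM, hMS⟩ := (mem_lyapunovModel_iff hC).1 (hsub hmem)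
  rw [← hdiag] at hMS
  refine ⟨_, hM.mul_mul fun hx hy hxy => ?_, hMS.restrict isSymm_offRangeDiagonal hRE hRQ⟩
  rw [range_of_ne_zero hx, range_of_ne_zero hy] at hxy
  exact hxy

end Marginal

/-- Pairing the Lyapunov equation with `Y` in the trace form shows that `Y` obstructs solutions
supported on `F`. -/
theorem LyapunovEq.trace_eq_zero {U : Type} [Fintype U] [DecidableEq U] {F : LoopedDigraph U}
    {N T Y : Matrix U U ℝ} (h : LyapunovEq N T 1) (hN : IsSparseMatrix F N) (hT : T.IsSymm)
    (hY : Y.IsSymm) (hYT : ∀ x y, F.Adj x y → (Y * T) y x = 0) : Y.trace = 0 := by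
  have orthogonal : (Y * (T * Nᵀ)).trace = 0 := by
    rw [← Matrix.mul_assoc, Matrix.trace]
    refine Finset.sum_eq_zero fun y _ => ?_
    rw [Matrix.diag_apply, Matrix.mul_apply]
    refine Finset.sum_eq_zero fun x _ => ?_
    by_cases hxy : F.Adj x y
    · rw [hYT x y hxy, zero_mul]
    · rw [Matrix.transpose_apply, hN x y hxy, mul_zero]
  have orthogonal' : (Y * (N * T)).trace = 0 := by
    rw [← orthogonal, ← Matrix.trace_transpose (Y * (N * T)), Matrix.transpose_mul,
      Matrix.transpose_mul, hT.eq, hY.eq, Matrix.trace_mul_comm]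
  have total := congrArg (fun A => (Y * A).trace) h
  simpa only [Matrix.mul_add, Matrix.trace_add, orthogonal, orthogonal', Matrix.mul_one,
    Matrix.mul_zero, Matrix.trace_zero, zero_add] using total

/-- A solution of a Lyapunov equation with identity volatility in exact arithmetic: `drift` is
twice the drift matrix, and the remaining fields record that a positive multiple of `cov` is
congruent to a positive diagonal matrix. -/
structure IntegerLyapunov (n : ℕ) where
  cov : Matrix (Fin n) (Fin n) ℤ
  drift : Matrix (Fin n) (Fin n) ℤ
  congruence : Matrix (Fin n) (Fin n) ℤ
  weight : Fin n → ℤ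
  scale : ℤ
  lyapunov : drift * cov + cov * driftᵀ + 2 = 0 := by decide +kernel
  congruent : congruenceᵀ * Matrix.diagonal weight * congruence = scale • cov := by decide +kernel
  det_ne_zero : congruence.det ≠ 0 := by decide +kernel
  weight_pos : ∀ x, 0 < weight x := by decide +kernel
  scale_pos : 0 < scale := by decide +kernel

namespace IntegerLyapunov

variable {n : ℕ}

/-- The covariance matrix with real entries. -/
def realCov (W : IntegerLyapunov n) : Matrix (Fin n) (Fin n) ℝ :=
  W.cov.map (Int.castRingHom ℝ)

/-- The drift matrix with real entries. -/
noncomputable def realDrift (W : IntegerLyapunov n) : Matrix (Fin n) (Fin n) ℝ :=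
  (1 / 2 : ℝ) • W.drift.map (Int.castRingHom ℝ)

theorem lyapunovEq (W : IntegerLyapunov n) : LyapunovEq W.realDrift W.realCov 1 := by
  have h := congrArg (Int.castRingHom ℝ).mapMatrix W.lyapunov
  simp only [map_add, map_mul, map_zero, map_ofNat, RingHom.mapMatrix_apply,
    Matrix.transpose_map] at h
  have half : (1 : Matrix (Fin n) (Fin n) ℝ) = (1 / 2 : ℝ) • 2 := by
    rw [← one_add_one_eq_two (R := Matrix _ _ ℝ)]
    module
  rw [LyapunovEq, realDrift, realCov, Matrix.transpose_smul, Matrix.smul_mul, Matrix.mul_smul,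
    half, ← smul_add, ← smul_add, h, smul_zero]

theorem posDef_realCov (W : IntegerLyapunov n) : W.realCov.PosDef := by
  have hscale : (0 : ℝ) < W.scale := Int.cast_pos.2 W.scale_pos
  have hdiag : (Matrix.diagonal fun x => (W.weight x : ℝ)).PosDef :=
    Matrix.PosDef.diagonal fun x => Int.cast_pos.2 (W.weight_pos x)
  set B := W.congruence.map (Int.castRingHom ℝ) with hB
  have hunit : IsUnit B := by
    rw [Matrix.isUnit_iff_isUnit_det, isUnit_iff_ne_zero, hB, ← RingHom.mapMatrix_apply,
      ← RingHom.map_det]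
    exact Int.cast_ne_zero.2 W.det_ne_zero
  have hpos := hdiag.conjTranspose_mul_mul_same (B := B)
    (Matrix.mulVec_injective_iff_isUnit.2 hunit)
  have h := congrArg (Int.castRingHom ℝ).mapMatrix W.congruent
  simp only [map_mul, map_zsmul, RingHom.mapMatrix_apply, Matrix.transpose_map,
    Matrix.diagonal_map (map_zero _)] at h
  have hcov : Bᵀ * Matrix.diagonal (fun x => (W.weight x : ℝ)) * B = (W.scale : ℝ) • W.realCov :=
    h.trans (Int.cast_smul_eq_zsmul ℝ W.scale W.realCov).symm
  rw [← inv_smul_smul₀ hscale.ne' W.realCov, ← hcov,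
    ← Matrix.conjTranspose_eq_transpose_of_trivial]
  exact hpos.smul (inv_pos.2 hscale)

theorem not_subset {V : Type} [Fintype V] [DecidableEq V] {G H : LoopedDigraph V} {c : V → ℝ}
    (W : IntegerLyapunov n) (Y : Matrix (Fin n) (Fin n) ℤ) {f : Fin n → V} (hc : ∀ k, 0 < c k)
    (hY : Y.IsSymm) (htrace : Y.trace ≠ 0)
    (hdist : ∀ x y, x < y → (Y * W.cov) x y ≠ 0 ∨ (Y * W.cov) y x ≠ 0)
    (hG : ∀ x y, W.drift y x ≠ 0 → G.Adj (f x) (f y))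
    (hH : ∀ x y, (Y * W.cov) y x ≠ 0 → ¬ H.Adj (f x) (f y)) :
    ¬ lyapunovModel G (Matrix.diagonal c) ⊆ lyapunovModel H (Matrix.diagonal c) := by
  intro hsub
  have hf : f.Injective := Function.Injective.of_lt_imp_ne fun x y hxy e => by
    rcases hdist x y hxy with h | h
    · exact hH y x h (e ▸ H.loop _)
    · exact hH x y h (e ▸ H.loop _)
  have hN : IsSparseMatrix (G.comap f) W.realDrift := by
    intro x y hxy
    have h0 : W.drift y x = 0 := not_not.1 fun h => hxy (hG x y h)
    simp [realDrift, h0]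
  obtain ⟨N, hNH, hNT⟩ := exists_isSparseMatrix_comap_of_lyapunovModel_subset hc hsub hf
    W.posDef_realCov hN W.lyapunovEq
  have hYT (x y) (hxy : (H.comap f).Adj x y) :
      (Y.map (Int.castRingHom ℝ) * W.realCov) y x = 0 := by
    have h0 : (Y * W.cov) y x = 0 := not_not.1 fun h => hH x y h hxy
    rw [realCov, ← Matrix.map_mul, Matrix.map_apply, h0, map_zero]
  have h0 := hNT.trace_eq_zero hNH (isSymm_of_posDef W.posDef_realCov) (hY.map _) hYT
  rw [← AddMonoidHom.map_trace] at h0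
  exact htrace (Int.cast_eq_zero.1 h0)

/-- A solution supported on the edge `0 → 1`. -/
def edge : IntegerLyapunov 2 where
  cov := !![1, 1; 1, 3]
  drift := !![-1, 0; 2, -1]
  congruence := !![1, 1; 0, 1]
  weight := ![1, 2]
  scale := 1

/-- A solution supported on the edges `0 → 1` and `1 → 2`. -/
def chain : IntegerLyapunov 3 where
  cov := !![1, 1, 1; 1, 3, 4; 1, 4, 9]
  drift := !![-1, 0, 0; 2, -1, 0; 0, 2, -1]
  congruence := !![1, 1, 1; 0, 2, 3; 0, 0, 1]
  weight := ![2, 1, 7]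
  scale := 2

/-- A solution supported on the edges `0 → 2` and `1 → 2`. -/
def collider : IntegerLyapunov 3 where
  cov := !![1, 0, 1; 0, 1, 1; 1, 1, 5]
  drift := !![-1, 0, 0; 0, -1, 0; 2, 2, -1]
  congruence := !![1, 0, 1; 0, 1, 1; 0, 0, 1]
  weight := ![1, 1, 3]
  scale := 1

/-- A solution supported on the edges `0 → 1`, `1 → 2`, `1 → 3` and `2 → 3`. -/
def grandparent : IntegerLyapunov 4 where
  cov := !![1, 1, 1, 1; 1, 3, 4, 3; 1, 4, 9, 2; 1, 3, 2, 9]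
  drift := !![-1, 0, 0, 0; 2, -1, 0, 0; 0, 2, -1, 0; 0, 4, -2, -1]
  congruence := !![1, 1, 1, 1; 0, 2, 3, 2; 0, 0, 7, -4; 0, 0, 0, 1]
  weight := ![14, 7, 1, 68]
  scale := 14

/-- A solution supported on the edges `0 → 1`, `0 → 2`, `1 → 2` and `2 → 3`. -/
def grandchild : IntegerLyapunov 4 where
  cov := !![1, 1, 0, 0; 1, 3, -2, -2; 0, -2, 5, 7; 0, -2, 7, 15]
  drift := !![-1, 0, 0, 0; 2, -1, 0, 0; 2, -2, -1, 0; 0, 0, 2, -1]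
  congruence := !![1, 1, 0, 0; 0, 1, -1, -1; 0, 0, 3, 5; 0, 0, 0, 1]
  weight := ![3, 6, 1, 14]
  scale := 3

/-- A solution supported on the edges `0 → 1`, `0 → 2`, `1 → 2` and `0 → 3`. -/
def sibling : IntegerLyapunov 4 where
  cov := !![1, 1, 0, 1; 1, 3, -2, 2; 0, -2, 5, -1; 1, 2, -1, 3]
  drift := !![-1, 0, 0, 0; 2, -1, 0, 0; 2, -2, -1, 0; 2, 0, 0, -1]
  congruence := !![1, 1, 0, 1; 0, 2, -2, 1; 0, 0, 1, 0; 0, 0, 0, 1]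
  weight := ![2, 1, 6, 3]
  scale := 2

/-- A solution supported on the edges `0 → 1`, `0 → 2`, `1 → 2`, `1 → 3` and `2 → 3`. -/
def parentChild : IntegerLyapunov 4 where
  cov := !![1, 1, 0, 1; 1, 3, -2, 2; 0, -2, 5, 2; 1, 2, 2, 9]
  drift := !![-1, 0, 0, 0; 2, -1, 0, 0; 2, -2, -1, 0; 0, 2, 2, -1]
  congruence := !![1, 1, 0, 1; 0, 2, -2, 1; 0, 0, 1, 1; 0, 0, 0, 1]
  weight := ![2, 1, 6, 9]
  scale := 2

end IntegerLyapunov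

section NotSubset

open IntegerLyapunov

variable {V : Type} [Fintype V] [DecidableEq V] {G H : LoopedDigraph V} {c : V → ℝ}
  {a b i j k p : V}

/- Each dual matrix solves the linear conditions `(Y * cov) y x = 0` for all the pairs `(x, y)` that
the hypotheses leave as possible edges of `H`. -/

theorem lyapunovModel_not_subset_of_not_linked (hc : ∀ k, 0 < c k) (hab : G.Adj a b)
    (nab : ¬ H.Adj a b) (nba : ¬ H.Adj b a) :
    ¬ lyapunovModel G (Matrix.diagonal c) ⊆ lyapunovModel H (Matrix.diagonal c) := by
  refine edge.not_subset (f := ![a, b])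
    !![3, -3; -3, 1] hc (by decide) (by decide) (by decide) ?_ ?_
  · simp [Fin.forall_fin_succ, edge, hab, LoopedDigraph.loop]
  · simp [Fin.forall_fin_succ, edge, nab, nba]

theorem lyapunovModel_not_subset_of_chain (hc : ∀ k, 0 < c k) (hij : G.Adj i j) (hjk : G.Adj j k)
    (nij : ¬ H.Adj i j) (nik : ¬ H.Adj i k) (nki : ¬ H.Adj k i) (h : ¬ H.Adj j k ∨ ¬ H.Adj k j) :
    ¬ lyapunovModel G (Matrix.diagonal c) ⊆ lyapunovModel H (Matrix.diagonal c) := by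
  rcases h with h | h
  · refine chain.not_subset (f := ![i, j, k])
      !![99, -297, 198; -297, 135, -27; 198, -27, -10] hc (by decide) (by decide) (by decide) ?_ ?_
    · simp [Fin.forall_fin_succ, chain, hij, hjk, LoopedDigraph.loop]
    · simp [Fin.forall_fin_succ, chain, nij, nik, nki, h]
  · refine chain.not_subset (f := ![i, j, k])
      !![33, -99, 66; -99, 73, -30; 66, -30, 6] hc (by decide) (by decide) (by decide) ?_ ?_
    · simp [Fin.forall_fin_succ, chain, hij, hjk, LoopedDigraph.loop]
    · simp [Fin.forall_fin_succ, chain, nij, nik, nki, h]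

theorem lyapunovModel_not_subset_of_collider (hc : ∀ k, 0 < c k) (hij : G.Adj i j) (hkj : G.Adj k j)
    (nik : ¬ H.Adj i k) (nij : ¬ H.Adj i j) (nki : ¬ H.Adj k i) (h : ¬ H.Adj k j ∨ ¬ H.Adj j k) :
    ¬ lyapunovModel G (Matrix.diagonal c) ⊆ lyapunovModel H (Matrix.diagonal c) := by
  rcases h with h | h
  · refine collider.not_subset (f := ![i, k, j])
      !![5, 20, -5; 20, 5, -5; -5, -5, 2] hc (by decide) (by decide) (by decide) ?_ ?_
    · simp [Fin.forall_fin_succ, collider, hij, hkj, LoopedDigraph.loop]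
    · simp [Fin.forall_fin_succ, collider, nik, nij, nki, h]
  · refine collider.not_subset (f := ![i, k, j])
      !![4, 16, -4; 16, 1, -1; -4, -1, 1] hc (by decide) (by decide) (by decide) ?_ ?_
    · simp [Fin.forall_fin_succ, collider, hij, hkj, LoopedDigraph.loop]
    · simp [Fin.forall_fin_succ, collider, nik, nij, nki, h]

theorem lyapunovModel_not_subset_of_grandparent (hc : ∀ k, 0 < c k) (hpa : G.Adj p a)
    (hai : G.Adj a i) (haj : G.Adj a j) (hij : G.Adj i j) (npj : ¬ H.Adj p j) (nap : ¬ H.Adj a p)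
    (nip : ¬ H.Adj i p) (nia : ¬ H.Adj i a) (nij : ¬ H.Adj i j) (njp : ¬ H.Adj j p)
    (nja : ¬ H.Adj j a) :
    ¬ lyapunovModel G (Matrix.diagonal c) ⊆ lyapunovModel H (Matrix.diagonal c) := by
  refine grandparent.not_subset (f := ![p, a, i, j])
    !![-3, 0, 0, 3; 0, 1, 0, -1; 0, 0, 0, 0; 3, -1, 0, 0] hc
    (by decide) (by decide) (by decide) ?_ ?_
  · simp [Fin.forall_fin_succ, grandparent, hpa, hai, haj, hij, LoopedDigraph.loop]
  · simp [Fin.forall_fin_succ, grandparent, npj, nap, nip, nia, nij, njp, nja]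

theorem lyapunovModel_not_subset_of_grandchild (hc : ∀ k, 0 < c k) (hij : G.Adj i j)
    (hia : G.Adj i a) (hja : G.Adj j a) (hab : G.Adj a b) (nij : ¬ H.Adj i j) (nib : ¬ H.Adj i b)
    (njb : ¬ H.Adj j b) (nai : ¬ H.Adj a i) (naj : ¬ H.Adj a j) (nbi : ¬ H.Adj b i)
    (nbj : ¬ H.Adj b j) (nba : ¬ H.Adj b a) :
    ¬ lyapunovModel G (Matrix.diagonal c) ⊆ lyapunovModel H (Matrix.diagonal c) := by
  refine grandchild.not_subset (f := ![i, j, a, b])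
    !![1, -1, -16, 15; -1, -15, 16, -39; -16, 16, 40, -24; 15, -39, -24, 6] hc
    (by decide) (by decide) (by decide) ?_ ?_
  · simp [Fin.forall_fin_succ, grandchild, hij, hia, hja, hab, LoopedDigraph.loop]
  · simp [Fin.forall_fin_succ, grandchild, nij, nib, njb, nai, naj, nbi, nbj, nba]

theorem lyapunovModel_not_subset_of_sibling (hc : ∀ k, 0 < c k) (hai : G.Adj a i) (haj : G.Adj a j)
    (hij : G.Adj i j) (hab : G.Adj a b) (nia : ¬ H.Adj i a) (nij : ¬ H.Adj i j)
    (nib : ¬ H.Adj i b) (nja : ¬ H.Adj j a) (njb : ¬ H.Adj j b) (nba : ¬ H.Adj b a)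
    (nbi : ¬ H.Adj b i) (nbj : ¬ H.Adj b j) :
    ¬ lyapunovModel G (Matrix.diagonal c) ⊆ lyapunovModel H (Matrix.diagonal c) := by
  refine sibling.not_subset (f := ![a, i, j, b])
    !![-3, -1, 10, 4; -1, -1, 0, 2; 10, 0, -2, -10; 4, 2, -10, -6] hc
    (by decide) (by decide) (by decide) ?_ ?_
  · simp [Fin.forall_fin_succ, sibling, hai, haj, hij, hab, LoopedDigraph.loop]
  · simp [Fin.forall_fin_succ, sibling, nia, nij, nib, nja, njb, nba, nbi, nbj]

theorem lyapunovModel_not_subset_of_parent_child (hc : ∀ k, 0 < c k) (hai : G.Adj a i)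
    (haj : G.Adj a j) (hij : G.Adj i j) (hib : G.Adj i b) (hjb : G.Adj j b) (nab : ¬ H.Adj a b)
    (nia : ¬ H.Adj i a) (nij : ¬ H.Adj i j) (nja : ¬ H.Adj j a) (nba : ¬ H.Adj b a)
    (nbi : ¬ H.Adj b i) (nbj : ¬ H.Adj b j) :
    ¬ lyapunovModel G (Matrix.diagonal c) ⊆ lyapunovModel H (Matrix.diagonal c) := by
  refine parentChild.not_subset (f := ![a, i, j, b])
    !![-125, -45, -50, 170; -45, 135, 90, -90; -50, 90, 52, -40; 170, -90, -40, 10] hc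
    (by decide) (by decide) (by decide) ?_ ?_
  · simp [Fin.forall_fin_succ, parentChild, hai, haj, hij, hib, hjb, LoopedDigraph.loop]
  · simp [Fin.forall_fin_succ, parentChild, nab, nia, nij, nja, nba, nbi, nbj]

end NotSubset

namespace LoopedDigraph

variable {V : Type} {G H : LoopedDigraph V} {i j a z : V}

namespace TwinReversal

theorem not_adj_of_not_linked (h : TwinReversal G H) {x y : V} (hxy : ¬ G.Linked x y) :
    ¬ H.Adj x y ∧ ¬ H.Adj y x :=
  not_or.1 (mt h.linked.2 hxy)

theorem adj_and_not_adj (h : TwinReversal G H) {x y : V} (hxy : G.Adj x y)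
    (hz : ¬ (G.Linked x z ↔ G.Linked y z)) : H.Adj x y ∧ ¬ H.Adj y x := by
  have hne : x ≠ y := by
    rintro rfl
    exact hz Iff.rfl
  have hyx : ¬ H.Adj y x := fun hyx => hz (h.twins ⟨hne, hxy, hyx⟩ z)
  exact ⟨(h.linked.1 (Or.inl hxy)).resolve_right hyx, hyx⟩

section Reversed

variable (h : TwinReversal G H) (hij : (i, j) ∈ reversedEdges G H)

include h hij

theorem linked_left_iff_linked_right : G.Linked a i ↔ G.Linked a j :=
  ⟨fun ha => ((h.twins hij a).1 ha.symm).symm, fun ha => ((h.twins hij a).2 ha.symm).symm⟩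

theorem adj_right_of_adj_left (hG : G.IsAcyclic) (hai : G.Adj a i) : G.Adj a j :=
  ((h.linked_left_iff_linked_right hij).1 (Or.inl hai)).resolve_right fun hja =>
    hij.1 (hG.eq_of_triangle hij.2.1 hja hai).1

theorem left_adj_of_right_adj (hG : G.IsAcyclic) (hja : G.Adj j a) : G.Adj i a :=
  ((h.twins hij a).2 (Or.inl hja)).resolve_right fun hai =>
    hij.1 (hG.eq_of_triangle hij.2.1 hja hai).1

/-- Otherwise `H` contains the directed cycle `i → a → j → i`. -/
theorem right_adj_of_left_adj (hH : H.IsAcyclic) (hia : G.Adj i a)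
    (hz : ¬ (G.Linked i z ↔ G.Linked a z)) : G.Adj j a := by
  refine ((h.twins hij a).1 (Or.inl hia)).resolve_right fun haj => ?_
  have hHia := (h.adj_and_not_adj hia hz).1
  have hHaj := (h.adj_and_not_adj haj fun e => hz ((h.twins hij z).trans e.symm)).1
  obtain rfl := (hH.eq_of_triangle hij.2.2 hHia hHaj).2
  exact hz Iff.rfl

theorem adj_left_of_adj_right (hG : G.IsAcyclic) (hH : H.IsAcyclic) (haj : G.Adj a j)
    (hz : ¬ (G.Linked i z ↔ G.Linked a z)) : G.Adj a i := by
  refine ((h.linked_left_iff_linked_right hij).2 (Or.inl haj)).resolve_right fun hia => ?_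
  obtain rfl := hG.antisymm (h.right_adj_of_left_adj hij hH hia hz) haj
  exact hz (h.twins hij z)

theorem shielded_right (hG : G.IsAcyclic) (hH : H.IsAcyclic) (hi : G.Shielded i) :
    G.Shielded j where
  grandparent {a b} hba haj := by
    by_contra hbj
    have hib : ¬ G.Linked i b := fun e => hbj ((h.linked_left_iff_linked_right hij).1 e.symm)
    have hai := h.adj_left_of_adj_right hij hG hH haj fun e => hib (e.2 (Or.inr hba))
    exact hib (hi.grandparent hba hai).symm
  grandchild hja hab := (h.linked_left_iff_linked_right hij).1
    (hi.grandchild (h.left_adj_of_right_adj hij hG hja) hab)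
  sibling {a b} haj hab := by
    refine (h.linked_left_iff_linked_right hij).1 ?_
    rcases (h.linked_left_iff_linked_right hij).2 (Or.inl haj) with hai | hia
    · exact hi.sibling hai hab
    · exact hi.grandchild hia hab
  parent_child {a b} haj hjb := by
    by_contra hab
    have hib := h.left_adj_of_right_adj hij hG hjb
    exact hab (hi.parent_child (h.adj_left_of_adj_right hij hG hH haj
      fun e => hab (e.1 (Or.inl hib))) hib)

end Reversed

section Shielded

variable [Fintype V] [DecidableEq V] {c : V → ℝ} {b : V}

variable (h : TwinReversal G H) (hc : ∀ k, 0 < c k) (hG : G.IsAcyclic) (hH : H.IsAcyclic)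
  (hsub : lyapunovModel G (Matrix.diagonal c) ⊆ lyapunovModel H (Matrix.diagonal c))
  (hij : (i, j) ∈ reversedEdges G H)

include h hc hG hH hsub hij

theorem linked_of_grandparent (hba : G.Adj b a) (hai : G.Adj a i) : G.Linked b i := by
  by_contra hbi
  have hbj : ¬ G.Linked b j := mt (h.linked_left_iff_linked_right hij).2 hbi
  have haj := h.adj_right_of_adj_left hij hG hai
  have nij : ¬ H.Adj i j := fun hH' => hij.1 (hH.antisymm hH' hij.2.2)
  have nia := (h.adj_and_not_adj hai fun e => hbi (e.1 (Or.inr hba)).symm).2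
  have nja := (h.adj_and_not_adj haj fun e => hbj (e.1 (Or.inr hba)).symm).2
  have nab := (h.adj_and_not_adj hba fun e => hbi (e.2 (Or.inl hai))).2
  obtain ⟨-, nib⟩ := h.not_adj_of_not_linked hbi
  obtain ⟨nbj, njb⟩ := h.not_adj_of_not_linked hbj
  exact lyapunovModel_not_subset_of_grandparent hc hba hai haj hij.2.1 nbj nab nib nia nij njb nja
    hsub

omit hG in
theorem linked_of_grandchild (hia : G.Adj i a) (hab : G.Adj a b) : G.Linked b i := by
  by_contra hbi
  have hbj : ¬ G.Linked b j := mt (h.linked_left_iff_linked_right hij).2 hbi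
  have separated : ¬ (G.Linked i b ↔ G.Linked a b) := fun e => hbi (e.2 (Or.inl hab)).symm
  have hja := h.right_adj_of_left_adj hij hH hia separated
  have nij : ¬ H.Adj i j := fun hH' => hij.1 (hH.antisymm hH' hij.2.2)
  have nai := (h.adj_and_not_adj hia separated).2
  have naj := (h.adj_and_not_adj hja fun e => hbj (e.2 (Or.inl hab)).symm).2
  have nba := (h.adj_and_not_adj hab fun e => hbi (e.1 (Or.inr hia))).2
  obtain ⟨nbi, nib⟩ := h.not_adj_of_not_linked hbi
  obtain ⟨nbj, njb⟩ := h.not_adj_of_not_linked hbj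
  exact lyapunovModel_not_subset_of_grandchild hc hij.2.1 hia hja hab nij nib njb nai naj nbi nbj
    nba hsub

theorem linked_of_sibling (hai : G.Adj a i) (hab : G.Adj a b) : G.Linked b i := by
  by_contra hbi
  have hbj : ¬ G.Linked b j := mt (h.linked_left_iff_linked_right hij).2 hbi
  have haj := h.adj_right_of_adj_left hij hG hai
  have nij : ¬ H.Adj i j := fun hH' => hij.1 (hH.antisymm hH' hij.2.2)
  have nia := (h.adj_and_not_adj hai fun e => hbi (e.1 (Or.inl hab)).symm).2
  have nja := (h.adj_and_not_adj haj fun e => hbj (e.1 (Or.inl hab)).symm).2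
  have nba := (h.adj_and_not_adj hab fun e => hbi (e.1 (Or.inl hai))).2
  obtain ⟨nbi, nib⟩ := h.not_adj_of_not_linked hbi
  obtain ⟨nbj, njb⟩ := h.not_adj_of_not_linked hbj
  exact lyapunovModel_not_subset_of_sibling hc hai haj hij.2.1 hab nia nij nib nja njb nba nbi nbj
    hsub

theorem linked_of_parent_child (hai : G.Adj a i) (hib : G.Adj i b) : G.Linked a b := by
  by_contra hab
  have haj := h.adj_right_of_adj_left hij hG hai
  have separated : ¬ (G.Linked i a ↔ G.Linked b a) := fun e => hab (e.1 (Or.inr hai)).symm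
  have hjb := h.right_adj_of_left_adj hij hH hib separated
  have nij : ¬ H.Adj i j := fun hH' => hij.1 (hH.antisymm hH' hij.2.2)
  have nia := (h.adj_and_not_adj hai fun e => hab (e.2 (Or.inl hib))).2
  have nja := (h.adj_and_not_adj haj fun e => hab (e.2 (Or.inl hjb))).2
  have nbi := (h.adj_and_not_adj hib separated).2
  have nbj := (h.adj_and_not_adj hjb fun e => hab (e.1 (Or.inr haj)).symm).2
  obtain ⟨nab, nba⟩ := h.not_adj_of_not_linked hab
  exact lyapunovModel_not_subset_of_parent_child hc hai haj hij.2.1 hib hjb nab nia nij nja nba nbi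
    nbj hsub

theorem shielded_left : G.Shielded i where
  grandparent := h.linked_of_grandparent hc hG hH hsub hij
  grandchild := h.linked_of_grandchild hc hH hsub hij
  sibling := h.linked_of_sibling hc hG hH hsub hij
  parent_child := h.linked_of_parent_child hc hG hH hsub hij

end Shielded

end TwinReversal

section Criterion

variable [Fintype V] [DecidableEq V] {c : V → ℝ}

theorem linked_of_lyapunovModel_subset (hc : ∀ k, 0 < c k)
    (hsub : lyapunovModel G (Matrix.diagonal c) ⊆ lyapunovModel H (Matrix.diagonal c)) {x y : V}
    (hxy : G.Linked x y) : H.Linked x y := by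
  by_contra hn
  obtain ⟨nxy, nyx⟩ := not_or.1 hn
  rcases hxy with hxy | hyx
  · exact lyapunovModel_not_subset_of_not_linked hc hxy nxy nyx hsub
  · exact lyapunovModel_not_subset_of_not_linked hc hyx nyx nxy hsub

theorem linked_of_lyapunovModel_subset_of_mem_reversedEdges (hc : ∀ k, 0 < c k)
    (hH : H.IsAcyclic)
    (hsub : lyapunovModel G (Matrix.diagonal c) ⊆ lyapunovModel H (Matrix.diagonal c))
    (hij : (i, j) ∈ reversedEdges G H) {k : V} (hjk : G.Linked j k) : H.Linked i k := by
  by_contra hn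
  obtain ⟨hne, hGij, hHji⟩ := hij
  obtain ⟨nik, nki⟩ := not_or.1 hn
  have nij : ¬ H.Adj i j := fun hHij => hne (hH.antisymm hHij hHji)
  have one_direction : ¬ H.Adj j k ∨ ¬ H.Adj k j := by
    by_contra! hjk
    obtain rfl := hH.antisymm hjk.1 hjk.2
    exact nki hHji
  rcases hjk with hjk | hkj
  · exact lyapunovModel_not_subset_of_chain hc hGij hjk nij nik nki one_direction hsub
  · exact lyapunovModel_not_subset_of_collider hc hGij hkj nik nij nki one_direction.symm hsub

theorem modelEquivalent_iff (hc : ∀ k, 0 < c k) (hG : G.IsAcyclic) (hH : H.IsAcyclic) :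
    ModelEquivalent (Matrix.diagonal c) G H ↔ LocallyEquivalent G H := by
  refine ⟨fun h => ?_, fun h => h.lyapunovModel_eq hc hG hH⟩
  have hGH := h.subset
  have hHG := h.symm.subset
  have linked {a b : V} : G.Linked a b ↔ H.Linked a b :=
    ⟨linked_of_lyapunovModel_subset hc hGH, linked_of_lyapunovModel_subset hc hHG⟩
  have reversal : TwinReversal G H := by
    refine ⟨linked, fun {i j} hij k => ⟨fun hik => ?_, fun hjk => linked.2 ?_⟩⟩
    · exact linked_of_lyapunovModel_subset_of_mem_reversedEdges hc hG hHG
        ⟨hij.1.symm, hij.2.2, hij.2.1⟩ (linked.1 hik)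
    · exact linked_of_lyapunovModel_subset_of_mem_reversedEdges hc hH hGH hij hjk
  refine ⟨reversal, fun hij => ?_⟩
  have hi := reversal.shielded_left hc hG hH hGH hij
  exact ⟨hi, reversal.shielded_right hij hG hH hi⟩

theorem structurallyIdentifiableWithin_iff (hc : ∀ k, 0 < c k) (hG : G.IsAcyclic) :
    StructurallyIdentifiableWithin (Matrix.diagonal c) {H : LoopedDigraph V | H.IsAcyclic} G ↔
      ∀ i j, ¬ G.Reversible i j := by
  constructor
  · rintro ⟨-, unique⟩ i j hr
    have hswap : G.swap i j = G := unique.unique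
      ⟨hG.swap i j, (lyapunovModel_swap hc hG hr).symm⟩ ⟨hG, rfl⟩
    have hji : G.Adj j i := by
      rw [← G.swap_adj_left, hswap]
      exact hr.adj
    exact hr.ne (hG.antisymm hr.adj hji)
  · intro hr
    refine ⟨hG, G, ⟨hG, rfl⟩, ?_⟩
    rintro H ⟨hH, hGH⟩
    exact (((modelEquivalent_iff hc hG hH).1 hGH).eq_of_forall_not_reversible hG hH hr).symm

end Criterion

end LoopedDigraph

theorem initList_eq_update (T : Turing.FinTM2) (l : List (T.Γ T.k₀)) :
    Turing.initList T l =
      ⟨some T.main, T.initialState, Function.update (fun _ => []) T.k₀ l⟩ := by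
  refine congrArg (Turing.TM2.Cfg.mk _ _) (funext fun k => ?_)
  by_cases hk : k = T.k₀
  · subst hk
    simp
  · simp [hk]

theorem haltList_eq_update (T : Turing.FinTM2) (l : List (T.Γ T.k₁)) :
    Turing.haltList T l = ⟨none, T.initialState, Function.update (fun _ => []) T.k₁ l⟩ := by
  refine congrArg (Turing.TM2.Cfg.mk _ _) (funext fun k => ?_)
  by_cases hk : k = T.k₁
  · subst hk
    simp
  · simp [hk]

/-- Structured programs on stacks with contents in `Γ` and a register in `σ`. They are compiled to
multi-stack Turing machines, and their running time is that of the machine. -/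
inductive StackProgram {K : Type} (Γ : K → Type) (σ : Type) : Type
  | push (k : K) (f : σ → Γ k)
  | pop (k : K) (f : σ → Option (Γ k) → σ)
  | load (f : σ → σ)
  | seq (a b : StackProgram Γ σ)
  | ite (t : σ → Bool) (a b : StackProgram Γ σ)
  /-- pop a symbol and update the register; if the register passes the test, then execute the
  body and start again, else leave the loop -/
  | loop (k : K) (f : σ → Option (Γ k) → σ) (t : σ → Bool) (a : StackProgram Γ σ)

namespace StackProgram

section Compilation

variable {K : Type} {Γ : K → Type} {σ : Type}

/-- The labels of the compiled program. -/
def Label : StackProgram Γ σ → Type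
  | push _ _ | pop _ _ | load _ => Unit
  | seq a b => a.Label ⊕ b.Label
  | ite _ a b => Option (a.Label ⊕ b.Label)
  | loop _ _ _ a => Option a.Label

instance finite_label (c : StackProgram Γ σ) : Finite c.Label := by
  induction c <;> (simp only [Label]; infer_instance)

/-- The label at which a program starts. -/
def entry : ∀ c : StackProgram Γ σ, c.Label
  | push _ _ | pop _ _ | load _ => ()
  | seq a _ => Sum.inl a.entry
  | ite _ _ _ | loop _ _ _ _ => none

/-- The statements of the compiled program: `emb` embeds its labels into those of the whole
machine, and `exit` is the label at which the machine continues afterwards. -/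
def code {Λ : Type} :
    ∀ c : StackProgram Γ σ, (c.Label → Λ) → Λ → c.Label → Turing.TM2.Stmt Γ Λ σ
  | push k f, _, exit, _ => .push k f (.goto fun _ => exit)
  | pop k f, _, exit, _ => .pop k f (.goto fun _ => exit)
  | load f, _, exit, _ => .load f (.goto fun _ => exit)
  | seq a b, emb, _, Sum.inl l => a.code (emb ∘ Sum.inl) (emb (Sum.inr b.entry)) l
  | seq _ b, emb, exit, Sum.inr l => b.code (emb ∘ Sum.inr) exit l
  | ite t a b, emb, _, none =>
      .branch t (.goto fun _ => emb (some (Sum.inl a.entry)))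
        (.goto fun _ => emb (some (Sum.inr b.entry)))
  | ite _ a _, emb, exit, some (Sum.inl l) => a.code (emb ∘ some ∘ Sum.inl) exit l
  | ite _ _ b, emb, exit, some (Sum.inr l) => b.code (emb ∘ some ∘ Sum.inr) exit l
  | loop k f t a, emb, exit, none =>
      .pop k f (.branch t (.goto fun _ => emb (some a.entry)) (.goto fun _ => exit))
  | loop _ _ _ a, emb, _, some l => a.code (emb ∘ some) (emb none) l

variable [DecidableEq K]

/-- `Runs c s S s' S' n`: started with the register `s` and the stacks `S`, the program `c` stops
after `n` steps with the register `s'` and the stacks `S'`. -/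
inductive Runs :
    StackProgram Γ σ → σ → (∀ k, List (Γ k)) → σ → (∀ k, List (Γ k)) → ℕ → Prop
  | push (k f s S) : Runs (.push k f) s S s (Function.update S k (f s :: S k)) 1
  | pop (k f s S) : Runs (.pop k f) s S (f s (S k).head?) (Function.update S k (S k).tail) 1
  | load (f s S) : Runs (.load f) s S (f s) S 1
  | seq {a b s S s₁ S₁ s₂ S₂ n₁ n₂} : Runs a s S s₁ S₁ n₁ → Runs b s₁ S₁ s₂ S₂ n₂ →
      Runs (.seq a b) s S s₂ S₂ (n₁ + n₂)
  | ite_true {t a b s S s₁ S₁ n} : t s = true → Runs a s S s₁ S₁ n →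
      Runs (.ite t a b) s S s₁ S₁ (1 + n)
  | ite_false {t a b s S s₁ S₁ n} : t s = false → Runs b s S s₁ S₁ n →
      Runs (.ite t a b) s S s₁ S₁ (1 + n)
  | loop_exit {k f t a s S} : t (f s (S k).head?) = false →
      Runs (.loop k f t a) s S (f s (S k).head?) (Function.update S k (S k).tail) 1
  | loop_step {k f t a s S s₁ S₁ n₁ s₂ S₂ n₂} : t (f s (S k).head?) = true →
      Runs a (f s (S k).head?) (Function.update S k (S k).tail) s₁ S₁ n₁ →
      Runs (.loop k f t a) s₁ S₁ s₂ S₂ n₂ →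
      Runs (.loop k f t a) s S s₂ S₂ (1 + n₁ + n₂)

theorem iterate_add_eq_of_eq {α : Type*} {f : α → α} {x y z : α} {m n : ℕ} (h₁ : f^[m] x = y)
    (h₂ : f^[n] y = z) : f^[m + n] x = z := by
  rw [Nat.add_comm, Function.iterate_add_apply, h₁, h₂]

theorem Runs.iterate_step {c : StackProgram Γ σ} {s S s' S' n} (h : Runs c s S s' S' n) {Λ : Type}
    {m : Λ → Turing.TM2.Stmt Γ Λ σ} {emb : c.Label → Λ} {exit : Λ}
    (hm : ∀ l, m (emb l) = c.code emb exit l) :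
    (flip bind (Turing.TM2.step m))^[n] (some ⟨some (emb c.entry), s, S⟩) =
      some ⟨some exit, s', S'⟩ := by
  have step_eq (l : Λ) (s : σ) (S : ∀ k, List (Γ k)) :
      (flip bind (Turing.TM2.step m))^[1] (some ⟨some l, s, S⟩) =
        some (Turing.TM2.stepAux (m l) s S) := rfl
  induction h generalizing exit with
  | push | pop | load => simp only [step_eq, hm, code, Turing.TM2.stepAux]
  | seq _ _ ih₁ ih₂ =>
    exact iterate_add_eq_of_eq (ih₁ fun l => hm (Sum.inl l)) (ih₂ fun l => hm (Sum.inr l))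
  | ite_true ht _ ih =>
    refine iterate_add_eq_of_eq ?_ (ih fun l => hm (some (Sum.inl l)))
    rw [step_eq, entry, hm none, code]
    simp only [Turing.TM2.stepAux, ht, cond]
  | ite_false ht _ ih =>
    refine iterate_add_eq_of_eq ?_ (ih fun l => hm (some (Sum.inr l)))
    rw [step_eq, entry, hm none, code]
    simp only [Turing.TM2.stepAux, ht, cond]
  | loop_exit ht =>
    rw [step_eq, entry, hm none, code]
    simp only [Turing.TM2.stepAux, ht, cond]
  | loop_step ht _ _ ih₁ ih₂ =>
    refine iterate_add_eq_of_eq (iterate_add_eq_of_eq ?_ (ih₁ fun l => hm (some l))) (ih₂ hm)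
    rw [step_eq, entry, hm none, code]
    simp only [Turing.TM2.stepAux, ht, cond]

/-- The Turing machine that executes a program, started with the register `s₀`, and halts. -/
def machine [Fintype K] [∀ k, Fintype (Γ k)] [Fintype σ] (c : StackProgram Γ σ)
    [Fintype c.Label] (s₀ : σ) (k₀ k₁ : K) : Turing.FinTM2 where
  K := K
  k₀ := k₀
  k₁ := k₁
  Γ := Γ
  Λ := Option c.Label
  main := some c.entry
  σ := σ
  initialState := s₀
  m
    | none => .halt
    | some l => c.code some none l

theorem decidableInPolyTime_of_runs [Finite K] [∀ k, Finite (Γ k)] [Finite σ] {α Γ₀ : Type}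
    {enc : α → List Γ₀} {P : α → Prop} (c : StackProgram Γ σ) (s₀ : σ) {k₀ k₁ : K}
    (e₀ : Γ k₀ ≃ Γ₀) (e₁ : Γ k₁ ≃ Bool) (p : Polynomial ℕ) (f : α → Bool)
    (hf : ∀ a, f a = true ↔ P a)
    (h : ∀ a, ∃ n ≤ p.eval (enc a).length,
      Runs c s₀ (Function.update (fun _ => []) k₀ ((enc a).map e₀.symm)) s₀
        (Function.update (fun _ => []) k₁ [e₁.symm (f a)]) n) :
    DecidableInPolyTime enc P := by
  choose n hn hr using h
  have : Fintype K := .ofFinite K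
  have : ∀ k, Fintype (Γ k) := fun k => .ofFinite (Γ k)
  have : Fintype σ := .ofFinite σ
  have : Fintype c.Label := .ofFinite c.Label
  have finite_alphabet : ∀ k, Finite (Γ k) := inferInstance
  let T := machine c s₀ k₀ k₁
  refine ⟨f, hf, ⟨⟨T, e₀, e₁⟩, p + 1, fun a => ⟨⟨n a + 1, ?_⟩, ?_⟩⟩,
    finite_alphabet⟩
  · have halts : ∀ S, (flip bind T.step)^[1] (some ⟨some none, s₀, S⟩) = some ⟨none, s₀, S⟩ :=
      fun _ => rfl
    simp only [Option.map_some, initList_eq_update, haltList_eq_update]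
    exact iterate_add_eq_of_eq ((hr a).iterate_step fun _ => rfl) (halts _)
  · simpa using hn a

end Compilation

end StackProgram

namespace StackProgram

section Rules

variable {K : Type} {Γ : K → Type} {σ : Type} [DecidableEq K] {a b : StackProgram Γ σ} {s : σ}
  {S S₁ S₂ : ∀ k, List (Γ k)} {N N₁ N₂ : ℕ}

/-- Started with the register `s` and the stacks `S`, the program `c` stops after at most `N` steps
with the stacks `S'`. -/
def RunsWithin (c : StackProgram Γ σ) (s : σ) (S S' : ∀ k, List (Γ k)) (N : ℕ) : Prop :=
  ∃ s' n, n ≤ N ∧ Runs c s S s' S' n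

/-- The program `c` transforms the stacks `S` into `S'` in at most `N` steps, whatever the register
contains. -/
def Transforms (c : StackProgram Γ σ) (S S' : ∀ k, List (Γ k)) (N : ℕ) : Prop :=
  ∀ s, c.RunsWithin s S S' N

theorem RunsWithin.mono (h : a.RunsWithin s S S₁ N₁) (hN : N₁ ≤ N₂) : a.RunsWithin s S S₁ N₂ := by
  obtain ⟨s', n, hn, hr⟩ := h
  exact ⟨s', n, hn.trans hN, hr⟩

theorem RunsWithin.seq (ha : a.RunsWithin s S S₁ N₁) (hb : b.Transforms S₁ S₂ N₂) :
    (a.seq b).RunsWithin s S S₂ (N₁ + N₂) := by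
  obtain ⟨s₁, n₁, h₁, r₁⟩ := ha
  obtain ⟨s₂, n₂, h₂, r₂⟩ := hb s₁
  exact ⟨s₂, _, add_le_add h₁ h₂, r₁.seq r₂⟩

theorem RunsWithin.ite {t : σ → Bool} (ha : t s = true → a.RunsWithin s S S₁ N)
    (hb : t s = false → b.RunsWithin s S S₁ N) : (ite t a b).RunsWithin s S S₁ (1 + N) := by
  cases ht : t s
  · obtain ⟨s', n, hn, hr⟩ := hb ht
    exact ⟨s', _, by gcongr, hr.ite_false ht⟩
  · obtain ⟨s', n, hn, hr⟩ := ha ht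
    exact ⟨s', _, by gcongr, hr.ite_true ht⟩

theorem Transforms.seq (ha : a.Transforms S S₁ N₁) (hb : b.Transforms S₁ S₂ N₂) :
    (a.seq b).Transforms S S₂ (N₁ + N₂) :=
  fun s => (ha s).seq hb

theorem Transforms.mono (h : a.Transforms S S₁ N₁) (hN : N₁ ≤ N₂) : a.Transforms S S₁ N₂ :=
  fun s => (h s).mono hN

theorem runsWithin_push (k : K) (f : σ → Γ k) (s : σ) (S : ∀ k, List (Γ k)) :
    (push k f).RunsWithin s S (Function.update S k (f s :: S k)) 1 :=
  ⟨s, 1, le_rfl, .push k f s S⟩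

theorem transforms_push_const (k : K) (x : Γ k) (S : ∀ k, List (Γ k)) :
    (push k fun _ => x : StackProgram Γ σ).Transforms S (Function.update S k (x :: S k)) 1 :=
  fun s => runsWithin_push k _ s S

theorem transforms_load (f : σ → σ) (S : ∀ k, List (Γ k)) :
    (load f : StackProgram Γ σ).Transforms S S 1 :=
  fun s => ⟨f s, 1, le_rfl, .load f s S⟩

section Loop

variable {k : K} {f : σ → Option (Γ k) → σ} {t : σ → Bool}

theorem transforms_loop (F : ℕ → ∀ k, List (Γ k)) {m : ℕ}
    (hF : ∀ i < m, ∀ s, t (f s (F i k).head?) = true ∧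
      a.RunsWithin (f s (F i k).head?) (Function.update (F i) k (F i k).tail) (F (i + 1)) N)
    (hm : ∀ s, t (f s (F m k).head?) = false) :
    (loop k f t a).Transforms (F 0) (Function.update (F m) k (F m k).tail)
      (m * (N + 1) + 1) := by
  intro s
  induction m generalizing F s with
  | zero => exact ⟨_, 1, by omega, .loop_exit (hm s)⟩
  | succ m ih =>
    obtain ⟨ht, s₁, n₁, hn₁, hr₁⟩ := hF 0 m.succ_pos s
    obtain ⟨s₂, n₂, hn₂, hr₂⟩ :=
      ih (fun i => F (i + 1)) (fun i hi => hF (i + 1) (Nat.succ_lt_succ hi)) hm s₁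
    exact ⟨s₂, 1 + n₁ + n₂, by linarith, .loop_step ht hr₁ hr₂⟩

theorem transforms_transfer {k' : K} (hk : k ≠ k') {g : σ → Γ k'} (e : Γ k → Γ k')
    (hnone : ∀ s, t (f s none) = false)
    (hsome : ∀ s x, t (f s (some x)) = true ∧ g (f s (some x)) = e x) (S : ∀ k, List (Γ k)) :
    (loop k f t (push k' g)).Transforms S
      (Function.update (Function.update S k []) k' (((S k).map e).reverse ++ S k'))
      ((S k).length * 2 + 1) := by
  let F (i : ℕ) : ∀ k, List (Γ k) := Function.update (Function.update S k ((S k).drop i)) k'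
    ((((S k).take i).map e).reverse ++ S k')
  have hFk (i : ℕ) : F i k = (S k).drop i := by simp [F, hk]
  have h : (loop k f t (push k' g)).Transforms (F 0) _ _ :=
    transforms_loop F (m := (S k).length) (N := 1) (fun i hi s => ?_) fun s => ?_
  · simpa [F, hk, hk.symm, Function.update_comm hk.symm, -List.map_take] using h
  · rw [hFk, List.drop_eq_getElem_cons hi]
    refine ⟨(hsome _ _).1, ?_⟩
    convert runsWithin_push k' g _ _ using 1
    simp [F, hk.symm, Function.update_comm hk, (hsome _ _).2, List.take_add_one, hi]
  · simp [hFk, hnone]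

theorem transforms_clear (hnone : ∀ s, t (f s none) = false)
    (hsome : ∀ s x, t (f s (some x)) = true) (S : ∀ k, List (Γ k)) :
    (loop k f t (load id)).Transforms S (Function.update S k []) ((S k).length * 2 + 1) := by
  have h := transforms_loop (f := f) (t := t) (a := load id) (N := 1)
    (fun i => Function.update S k ((S k).drop i)) (m := (S k).length) (fun i hi s => ?_)
    fun s => ?_
  · simpa using h
  · simp only [Function.update_self, Function.update_idem, List.drop_eq_getElem_cons hi,
      List.tail_cons]
    exact ⟨hsome _ _, transforms_load id _ _⟩
  · simp [hnone]

end Loop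

section ForAll

variable {ι : Type} {α : ι → Type}

/-- Execute the programs `body i` for all `i` in a list. -/
def forEach (body : ι → StackProgram Γ σ) : List ι → StackProgram Γ σ
  | [] => load id
  | i :: l => (body i).seq (forEach body l)

/-- Execute the programs `body i` for all `i` of a finite type, in an unspecified order. -/
noncomputable def forAll [Fintype ι] (body : ι → StackProgram Γ σ) : StackProgram Γ σ :=
  forEach body Finset.univ.toList

theorem transforms_forEach [DecidableEq ι] {body : ι → StackProgram Γ σ}
    (F : (∀ i, α i) → ∀ k, List (Γ k)) {x : ∀ i, α i} (y : ∀ i, α i)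
    (h : ∀ i z, z i = x i → (body i).Transforms (F z) (F (Function.update z i (y i))) N) :
    ∀ {l : List ι}, l.Nodup → ∀ z, (∀ i ∈ l, z i = x i) →
      (forEach body l).Transforms (F z) (F fun i => if i ∈ l then y i else z i) (l.length * N + 1)
  | [], _, z, _ => by simpa [forEach] using transforms_load id (F z)
  | i :: l, hl, z, hz => by
    obtain ⟨hil, hl⟩ := List.nodup_cons.1 hl
    have hrest := transforms_forEach F y h hl (Function.update z i (y i)) fun j hj => by
      rw [Function.update_of_ne (ne_of_mem_of_not_mem hj hil), hz j (List.mem_cons_of_mem i hj)]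
    refine ((h i z (hz i List.mem_cons_self)).seq ?_).mono (N₁ := N + (l.length * N + 1))
      (by rw [List.length_cons]; linarith)
    convert hrest using 2
    funext j
    by_cases hj : j = i
    · subst hj
      simp [hil]
    · simp [hj]

theorem transforms_forAll [Fintype ι] [DecidableEq ι] {body : ι → StackProgram Γ σ}
    (F : (∀ i, α i) → ∀ k, List (Γ k)) (x y : ∀ i, α i)
    (h : ∀ i z, z i = x i → (body i).Transforms (F z) (F (Function.update z i (y i))) N) :
    (forAll body).Transforms (F x) (F y) (Fintype.card ι * N + 1) := by
  simpa [forAll] using transforms_forEach F y h Finset.univ.nodup_toList x fun _ _ => rfl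

end ForAll

end Rules

end StackProgram

namespace StackProgram

/-- The counters of the programs that evaluate first-order properties of graphs: a scratch counter,
and for each of `m` variables its value and the number of its remaining values. -/
inductive Counter (m : ℕ)
  | scratch
  | val (v : Fin m)
  | rest (v : Fin m)
  deriving DecidableEq, Fintype

/-- The stacks of these programs: the input and its reversal, a tape for each graph and a stack
for the part of a tape that has been passed, the counters, and a stack of truth values. -/
inductive StackName (ι : Type) (m : ℕ)
  | input
  | buffer
  | tape (r : ι)
  | passed
  | counter (c : Counter m)
  | truth
  deriving DecidableEq, Fintype

/-- The alphabets of the stacks, for inputs over `Γ₀`; counters are written in unary. -/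
abbrev Alphabet (ι : Type) (m : ℕ) (Γ₀ : Type) : StackName ι m → Type
  | .input | .buffer => Γ₀
  | .tape _ | .passed => Option Bool
  | .counter _ => Unit
  | .truth => Bool

instance finite_alphabet (ι : Type) (m : ℕ) (Γ₀ : Type) [Finite Γ₀] :
    ∀ k, Finite (Alphabet ι m Γ₀ k)
  | .input | .buffer => inferInstanceAs (Finite Γ₀)
  | .tape _ | .passed => inferInstanceAs (Finite (Option Bool))
  | .counter _ => inferInstanceAs (Finite Unit)
  | .truth => inferInstanceAs (Finite Bool)

/-- The register of the programs: an input symbol, a tape symbol and two truth values. -/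
structure Register (Γ₀ : Type) where
  symbol : Option Γ₀
  cell : Option (Option Bool)
  fst : Bool
  snd : Bool

instance finite_register (Γ₀ : Type) [Finite Γ₀] : Finite (Register Γ₀) :=
  .of_injective (fun s => (s.symbol, s.cell, s.fst, s.snd)) fun s t h => by
    cases s
    cases t
    simpa using h

variable {ι : Type} {m : ℕ} {Γ₀ : Type}

/-- Stack contents, with counters as numbers. -/
structure Conf (ι : Type) (m : ℕ) (Γ₀ : Type) where
  input : List Γ₀ := []
  buffer : List Γ₀ := []
  tape : ι → List (Option Bool) := fun _ => []
  passed : List (Option Bool) := []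
  counter : Counter m → ℕ := fun _ => 0
  truth : List Bool := []

namespace Conf

/-- The stacks of a configuration. -/
def stk (C : Conf ι m Γ₀) : ∀ k, List (Alphabet ι m Γ₀ k)
  | .input => C.input
  | .buffer => C.buffer
  | .tape r => C.tape r
  | .passed => C.passed
  | .counter c => List.replicate (C.counter c) ()
  | .truth => C.truth

/-- Set a counter to a number. -/
def setCounter (C : Conf ι m Γ₀) (c : Counter m) (n : ℕ) : Conf ι m Γ₀ :=
  { C with counter := Function.update C.counter c n }

theorem setCounter_eq_self {C : Conf ι m Γ₀} {c : Counter m} {n : ℕ} (h : C.counter c = n) :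
    C.setCounter c n = C := by
  simp [setCounter, ← h]

theorem setCounter_setCounter (C : Conf ι m Γ₀) (c : Counter m) (n n' : ℕ) :
    (C.setCounter c n).setCounter c n' = C.setCounter c n' := by
  simp [setCounter]

theorem setCounter_comm {c c' : Counter m} (h : c ≠ c') (C : Conf ι m Γ₀) (n n' : ℕ) :
    (C.setCounter c n).setCounter c' n' = (C.setCounter c' n').setCounter c n := by
  simp [setCounter, Function.update_comm h]

section Update

variable [DecidableEq ι] (C : Conf ι m Γ₀)

theorem update_input (l : List Γ₀) :
    Function.update C.stk .input l = { C with input := l }.stk := by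
  funext k
  cases k <;> simp [stk]

theorem update_buffer (l : List Γ₀) :
    Function.update C.stk .buffer l = { C with buffer := l }.stk := by
  funext k
  cases k <;> simp [stk]

theorem update_tape (r : ι) (l : List (Option Bool)) :
    Function.update C.stk (.tape r) l =
      { C with tape := Function.update C.tape r l }.stk := by
  funext k
  cases k
  case tape r' => by_cases h : r' = r <;> [subst h; skip] <;> simp [stk, *]
  all_goals simp [stk]

theorem update_passed (l : List (Option Bool)) :
    Function.update C.stk .passed l = { C with passed := l }.stk := by
  funext k
  cases k <;> simp [stk]

theorem update_counter (c : Counter m) (n : ℕ) :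
    Function.update C.stk (.counter c) (List.replicate n ()) = (C.setCounter c n).stk := by
  funext k
  cases k
  case counter c' => by_cases h : c' = c <;> [subst h; skip] <;> simp [stk, setCounter, *]
  all_goals simp [stk, setCounter]

theorem update_truth (l : List Bool) :
    Function.update C.stk .truth l = { C with truth := l }.stk := by
  funext k
  cases k <;> simp [stk]

/-- Move `p` symbols of a tape to the stack of the symbols that have been passed. -/
def advance (r : ι) (p : ℕ) : Conf ι m Γ₀ :=
  { C with
    tape := Function.update C.tape r ((C.tape r).drop p)
    passed := ((C.tape r).take p).reverse ++ C.passed }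

theorem advance_zero (r : ι) : C.advance r 0 = C := by
  simp [advance]

theorem advance_advance (r : ι) (p q : ℕ) :
    (C.advance r p).advance r q = C.advance r (p + q) := by
  simp [advance, List.take_add]

theorem tape_advance (r : ι) (p : ℕ) : (C.advance r p).tape r = (C.tape r).drop p := by
  simp [advance]

end Update

end Conf

section Counters

variable [DecidableEq ι]

/-- Increase a counter. -/
def incr (c : Counter m) : StackProgram (Alphabet ι m Γ₀) (Register Γ₀) :=
  push (.counter c) fun _ => ()

theorem transforms_incr (c : Counter m) (C : Conf ι m Γ₀) (n : ℕ) :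
    (incr c).Transforms (C.setCounter c n).stk (C.setCounter c (n + 1)).stk 1 := by
  have h := transforms_push_const (σ := Register Γ₀) (.counter c) () (C.setCounter c n).stk
  have hn : (C.setCounter c n).stk (.counter c) = List.replicate n () := by
    simp [Conf.stk, Conf.setCounter]
  rwa [hn, ← List.replicate_succ, Conf.update_counter, Conf.setCounter_setCounter] at h

/-- Repeat the body while a counter can be decreased. -/
def countdown (c : Counter m) (body : StackProgram (Alphabet ι m Γ₀) (Register Γ₀)) :
    StackProgram (Alphabet ι m Γ₀) (Register Γ₀) :=
  loop (.counter c) (fun s o => { s with fst := o.isSome }) (fun s => s.fst) body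

variable {c c' : Counter m} {body : StackProgram (Alphabet ι m Γ₀) (Register Γ₀)} {k N : ℕ}

theorem transforms_countdown (F : ℕ → Conf ι m Γ₀)
    (hF : ∀ i < k, body.Transforms ((F i).setCounter c (k - (i + 1))).stk
      ((F (i + 1)).setCounter c (k - (i + 1))).stk N) :
    (countdown c body).Transforms ((F 0).setCounter c k).stk ((F k).setCounter c 0).stk
      (k * (N + 1) + 1) := by
  have hstk (i : ℕ) : ((F i).setCounter c (k - i)).stk (.counter c) =
      List.replicate (k - i) () := by
    simp [Conf.stk, Conf.setCounter]
  have h := transforms_loop (k := .counter c) (a := body) (m := k) (N := N)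
    (f := fun (s : Register Γ₀) o => { s with fst := o.isSome }) (t := fun s => s.fst)
    (fun i => ((F i).setCounter c (k - i)).stk) (fun i hi s => ?_) fun s => ?_
  · rwa [hstk, List.tail_replicate, Conf.update_counter, Conf.setCounter_setCounter,
      Nat.sub_self, Nat.sub_zero] at h
  · rw [hstk, List.tail_replicate, Conf.update_counter, Conf.setCounter_setCounter, Nat.sub_sub]
    have hpos : k - i ≠ 0 := by omega
    exact ⟨by simp [List.head?_replicate, hpos], hF i hi _⟩
  · simp [Conf.stk, Conf.setCounter]

/-- Move the contents of a counter to another one. -/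
def moveCounter (c c' : Counter m) : StackProgram (Alphabet ι m Γ₀) (Register Γ₀) :=
  countdown c (incr c')

theorem transforms_moveCounter (h : c ≠ c') (C : Conf ι m Γ₀) (k : ℕ) :
    (moveCounter c c').Transforms ((C.setCounter c' 0).setCounter c k).stk
      ((C.setCounter c' k).setCounter c 0).stk (k * 2 + 1) := by
  refine transforms_countdown (fun i => C.setCounter c' i) fun i _ => ?_
  simp only [Conf.setCounter_comm h.symm]
  exact transforms_incr c' _ i

/-- For each `i` below the value of the counter `c`, execute the body while `c'` is `i`. -/
def cycle (c c' : Counter m) (body : StackProgram (Alphabet ι m Γ₀) (Register Γ₀)) :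
    StackProgram (Alphabet ι m Γ₀) (Register Γ₀) :=
  (countdown c (body.seq (incr c'))).seq (moveCounter c' c)

theorem transforms_cycle (h : c ≠ c') (F : ℕ → Conf ι m Γ₀) (hc : (F 0).counter c = k)
    (hc' : (F 0).counter c' = 0) (hk : (F k).counter c = k) (hk' : (F k).counter c' = 0)
    (hF : ∀ i < k, body.Transforms (((F i).setCounter c' i).setCounter c (k - (i + 1))).stk
      (((F (i + 1)).setCounter c' i).setCounter c (k - (i + 1))).stk N) :
    (cycle c c' body).Transforms (F 0).stk (F k).stk (k * (N + 2) + 1 + (k * 2 + 1)) := by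
  have hcount := transforms_countdown (c := c) (body := body.seq (incr c')) (N := N + 1)
    (fun i => (F i).setCounter c' i) fun i hi => (hF i hi).seq ?_
  · have hmove := transforms_moveCounter h.symm (F k) k
    rw [Conf.setCounter_comm h] at hmove
    have := hcount.seq hmove
    rwa [Conf.setCounter_eq_self hc', Conf.setCounter_eq_self hc, Conf.setCounter_eq_self hk,
      Conf.setCounter_eq_self hk'] at this
  · simp only [Conf.setCounter_comm h.symm]
    exact transforms_incr c' _ i

end Counters

end StackProgram

open scoped Classical in
theorem exists_drop_encodeGraph {n : ℕ} (G : LoopedDigraph (Fin n)) (i : Fin n) :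
    ∃ w, (encodeGraph G).drop (i * (n + 1)) =
      (List.ofFn fun j => decide (G.Adj i j)).map some ++ none :: w := by
  have hi : (i : ℕ) < (adjRows G).length := by simp [adjRows]
  have hlen : ((adjRows G).map List.length).take i = List.replicate i (n + 1) := by
    simp [adjRows, List.map_ofFn, Function.comp_def, List.take_replicate]
  have hdrop := (adjRows G).drop_sum_flatten i
  rw [hlen, List.sum_replicate, smul_eq_mul, List.drop_eq_getElem_cons hi] at hdrop
  refine ⟨((adjRows G).drop (i + 1)).flatten, hdrop.trans ?_⟩
  simp [adjRows, List.map_ofFn, Function.comp_def]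

namespace StackProgram

variable {ι : Type} [DecidableEq ι] {m : ℕ} {Γ₀ : Type}

/-- Pass a symbol of a tape. -/
def readCell (r : ι) : StackProgram (Alphabet ι m Γ₀) (Register Γ₀) :=
  (pop (.tape r) fun s o => { s with cell := o }).seq (push .passed fun s => s.cell.getD none)

theorem runs_push_passed {r : ι} {C : Conf ι m Γ₀} {x : Option Bool} {w : List (Option Bool)}
    (h : C.tape r = x :: w) {f : Register Γ₀ → Option Bool} {s : Register Γ₀} (hf : f s = x) :
    Runs (push StackName.passed f) s (Function.update C.stk (.tape r) (C.stk (.tape r)).tail) s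
      (C.advance r 1).stk 1 := by
  convert Runs.push (Γ := Alphabet ι m Γ₀) .passed f s _ using 1
  rw [Conf.update_tape, Conf.update_passed]
  simp [Conf.advance, Conf.stk, h, hf]

theorem runs_readCell {r : ι} {C : Conf ι m Γ₀} {x : Option Bool} {w : List (Option Bool)}
    (h : C.tape r = x :: w) (s : Register Γ₀) :
    Runs (readCell r) s C.stk { s with cell := some x } (C.advance r 1).stk 2 := by
  have hpop := Runs.pop (.tape r) (fun (s : Register Γ₀) o => { s with cell := o }) s C.stk
  have hhead : (C.stk (.tape r)).head? = some x := congrArg List.head? h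
  rw [hhead] at hpop
  exact hpop.seq (runs_push_passed h rfl)

theorem transforms_readCell {r : ι} {C : Conf ι m Γ₀} (h : C.tape r ≠ []) :
    (readCell r).Transforms C.stk (C.advance r 1).stk 2 := by
  obtain ⟨x, w, hw⟩ := List.exists_cons_of_ne_nil h
  exact fun s => ⟨_, 2, le_rfl, runs_readCell hw s⟩

/-- Pass the symbols of a tape up to the next mark, including the mark. -/
def readRow (r : ι) : StackProgram (Alphabet ι m Γ₀) (Register Γ₀) :=
  (loop (.tape r) (fun s o => { s with cell := o }) (fun s => (s.cell.getD none).isSome)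
    (push .passed fun s => s.cell.getD none)).seq (push .passed fun _ => none)

theorem transforms_readRow {r : ι} {C : Conf ι m Γ₀} {row : List Bool} {w : List (Option Bool)}
    (h : C.tape r = row.map some ++ none :: w) :
    (readRow r).Transforms C.stk (C.advance r (row.length + 1)).stk (row.length * 2 + 2) := by
  have hend : (C.advance r row.length).tape r = none :: w := by
    rw [Conf.tape_advance, h, ← row.length_map some, List.drop_left]
  have hcons (i : ℕ) (hi : i < row.length) : (C.advance r i).tape r =
      some row[i] :: ((row.drop (i + 1)).map some ++ none :: w) := by
    rw [Conf.tape_advance, h, List.drop_append_of_le_length (by simpa using hi.le),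
      ← List.map_drop, List.drop_eq_getElem_cons hi, List.map_cons, List.cons_append]
  have hloop := transforms_loop (N := 1) (k := .tape r)
    (f := fun (s : Register Γ₀) o => { s with cell := o })
    (t := fun s => (s.cell.getD none).isSome) (a := push .passed fun s => s.cell.getD none)
    (fun i => (C.advance r i).stk) (m := row.length) (fun i hi s => ?_) fun s => ?_
  · have hmark := hloop.seq fun s => ⟨s, 1, le_rfl, runs_push_passed hend (f := fun _ => none) rfl⟩
    rwa [Conf.advance_zero, Conf.advance_advance] at hmark
  · have hhead : ((C.advance r i).stk (.tape r)).head? = some (some row[i]) :=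
      congrArg List.head? (hcons i hi)
    rw [hhead, ← Conf.advance_advance]
    exact ⟨rfl, _, 1, le_rfl, runs_push_passed (hcons i hi) rfl⟩
  · have hhead : ((C.advance r row.length).stk (.tape r)).head? = some none :=
      congrArg List.head? hend
    rw [hhead]
    rfl

/-- Restore a tape. -/
def unwind (r : ι) : StackProgram (Alphabet ι m Γ₀) (Register Γ₀) :=
  loop .passed (fun s o => { s with cell := o }) (fun s => s.cell.isSome)
    (push (.tape r) fun s => s.cell.getD none)

theorem transforms_unwind {r : ι} {C : Conf ι m Γ₀} (h : C.passed = []) (p : ℕ) :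
    (unwind r).Transforms (C.advance r p).stk C.stk ((C.tape r).length * 2 + 1) := by
  have htransfer := transforms_transfer (k := .passed) (k' := .tape r) (by simp)
    (f := fun (s : Register Γ₀) o => { s with cell := o }) (t := fun s => s.cell.isSome)
    (g := fun s => s.cell.getD none) id (fun _ => rfl) (fun _ _ => ⟨rfl, rfl⟩) (C.advance r p).stk
  rw [Conf.update_passed, Conf.update_tape] at htransfer
  have hlen : ((C.advance r p).stk .passed).length ≤ (C.tape r).length := by
    simp [Conf.advance, Conf.stk, h]
  refine Transforms.mono (N₁ := ((C.advance r p).stk .passed).length * 2 + 1) ?_ (by gcongr)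
  convert htransfer using 2
  · rfl
  cases C
  cases h
  simp [Conf.advance, Conf.stk]

/-- For a variable with value `i`, pass the first `i` rows of a tape. -/
def seekRow (r : ι) (v : Fin m) : StackProgram (Alphabet ι m Γ₀) (Register Γ₀) :=
  cycle (.val v) .scratch (readRow r)

/-- For a variable with value `j`, pass the first `j` symbols of a tape. -/
def seekCell (r : ι) (v : Fin m) : StackProgram (Alphabet ι m Γ₀) (Register Γ₀) :=
  cycle (.val v) .scratch (readCell r)

section Seek

variable {r : ι} {v : Fin m} {C : Conf ι m Γ₀} {i : ℕ}

theorem transforms_seekRow {n : ℕ} {G : LoopedDigraph (Fin n)} (hC : C.tape r = encodeGraph G)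
    (hscratch : C.counter .scratch = 0) (hv : C.counter (.val v) = i) (hi : i ≤ n) :
    (seekRow r v).Transforms C.stk (C.advance r (i * (n + 1))).stk
      (i * (n * 2 + 4) + 1 + (i * 2 + 1)) := by
  have h := transforms_cycle (c := .val v) (c' := .scratch) (k := i) (N := n * 2 + 2)
    (body := readRow r) (by simp) (fun p => C.advance r (p * (n + 1))) hv hscratch hv hscratch
    fun p hp => ?_
  · rwa [Nat.zero_mul, Conf.advance_zero] at h
  · obtain ⟨w, hdrop⟩ := exists_drop_encodeGraph G ⟨p, hp.trans_le hi⟩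
    have hread := transforms_readRow (C := (((C.advance r (p * (n + 1))).setCounter .scratch
      p).setCounter (.val v) (i - (p + 1)))) (w := w) (r := r) 
      ((Conf.tape_advance C r _).trans (hC ▸ hdrop))
    rw [List.length_ofFn] at hread
    rw [Nat.succ_mul, ← Conf.advance_advance]
    exact hread

theorem transforms_seekCell (hscratch : C.counter .scratch = 0) (hv : C.counter (.val v) = i)
    (hi : i ≤ (C.tape r).length) :
    (seekCell r v).Transforms C.stk (C.advance r i).stk (i * 4 + 1 + (i * 2 + 1)) := by
  have h := transforms_cycle (c := .val v) (c' := .scratch) (k := i) (N := 2)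
    (body := readCell r) (by simp) (fun p => C.advance r p) hv hscratch hv hscratch
    fun p hp => ?_
  · rwa [Conf.advance_zero] at h
  · rw [← Conf.advance_advance]
    refine transforms_readCell ?_
    simp only [Conf.setCounter, Conf.tape_advance, ne_eq, List.drop_eq_nil_iff]
    omega

end Seek

/-- Pass a symbol of a tape and note it as a truth value. -/
def noteCell (r : ι) : StackProgram (Alphabet ι m Γ₀) (Register Γ₀) :=
  (readCell r).seq (push .truth fun s => (s.cell.getD none).getD false)

theorem transforms_noteCell {r : ι} {C : Conf ι m Γ₀} {b : Bool} {w : List (Option Bool)}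
    (h : C.tape r = some b :: w) :
    (noteCell r).Transforms C.stk { C.advance r 1 with truth := b :: C.truth }.stk 3 := by
  intro s
  have hpush := (runs_readCell h s).seq (Runs.push .truth
    (fun s : Register Γ₀ => (s.cell.getD none).getD false) _ _)
  rw [Conf.update_truth] at hpush
  exact ⟨_, 3, le_rfl, hpush⟩

/-- Note whether there is an edge between two variables. -/
def query (r : ι) (v w : Fin m) : StackProgram (Alphabet ι m Γ₀) (Register Γ₀) :=
  (seekRow r v).seq ((seekCell r w).seq ((noteCell r).seq (unwind r)))

open scoped Classical in
theorem transforms_query {n : ℕ} {G : LoopedDigraph (Fin n)} {r : ι} {v w : Fin m} {i j : Fin n}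
    {C : Conf ι m Γ₀} (hC : C.tape r = encodeGraph G) (hpassed : C.passed = [])
    (hscratch : C.counter .scratch = 0) (hv : C.counter (.val v) = i)
    (hw : C.counter (.val w) = j) :
    (query r v w).Transforms C.stk { C with truth := decide (G.Adj i j) :: C.truth }.stk
      (n * (n * 2 + 4) + n * 8 + n * (n + 1) * 2 + 8) := by
  obtain ⟨u, hdrop⟩ := exists_drop_encodeGraph G i
  set row := List.ofFn fun j => decide (G.Adj i j)
  have hj : (j : ℕ) < row.length := by simp [row]
  have htape : (C.advance r (i * (n + 1))).tape r = row.map some ++ none :: u := by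
    rw [Conf.tape_advance, hC, hdrop]
  have hrow' := transforms_seekRow hC hscratch hv i.2.le
  have hcell := transforms_seekCell (C := C.advance r (i * (n + 1))) (r := r) (v := w)
    hscratch hw (by rw [htape]; simp [row]; omega)
  rw [Conf.advance_advance] at hcell
  have htape' : (C.advance r (i * (n + 1) + j)).tape r =
      some row[(j : ℕ)] :: ((row.drop (j + 1)).map some ++ none :: u) := by
    rw [← Conf.advance_advance, Conf.tape_advance, htape,
      List.drop_append_of_le_length (by simpa using hj.le), ← List.map_drop,
      List.drop_eq_getElem_cons hj, List.map_cons, List.cons_append]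
  have hnote := transforms_noteCell htape'
  rw [Conf.advance_advance] at hnote
  have hunwind := transforms_unwind (r := r) (C := { C with truth := row[(j : ℕ)] :: C.truth })
    hpassed (i * (n + 1) + j + 1)
  have hbit : row[(j : ℕ)] = decide (G.Adj i j) := by simp [row]
  rw [← hbit]
  refine (hrow'.seq (hcell.seq (hnote.seq hunwind))).mono ?_
  rw [hC, length_encodeGraph]
  nlinarith [i.2, j.2]

end StackProgram

namespace StackProgram

variable {ι : Type} {m n d : ℕ} {Γ₀ : Type}

/-- Replace the two topmost truth values by the value of a Boolean operation. -/
def connect (f : Bool → Bool → Bool) : StackProgram (Alphabet ι m Γ₀) (Register Γ₀) :=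
  (pop .truth fun s o => { s with snd := o.getD false }).seq
    ((pop .truth fun s o => { s with fst := o.getD false }).seq
      (push .truth fun s => f s.fst s.snd))

theorem transforms_connect [DecidableEq ι] (f : Bool → Bool → Bool) (C : Conf ι m Γ₀) (a b : Bool) :
    (connect f).Transforms { C with truth := b :: a :: C.truth }.stk
      { C with truth := f a b :: C.truth }.stk 3 := by
  intro s
  have hsnd := Runs.pop (Γ := Alphabet ι m Γ₀) .truth
    (fun (s : Register Γ₀) o => { s with snd := o.getD false }) s
    { C with truth := b :: a :: C.truth }.stk
  have hfst := Runs.pop (Γ := Alphabet ι m Γ₀) .truth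
    (fun (s : Register Γ₀) o => { s with fst := o.getD false }) { s with snd := b }
    { C with truth := a :: C.truth }.stk
  have hpush := Runs.push (Γ := Alphabet ι m Γ₀) .truth (fun s : Register Γ₀ => f s.fst s.snd)
    { s with fst := a, snd := b } C.stk
  rw [Conf.update_truth] at hsnd hfst hpush
  exact ⟨_, 3, le_rfl, hsnd.seq (hfst.seq hpush)⟩

/-- The tapes contain the graphs `G`, the first `d` variables have the values `x`, and the other
variables are ready to run through all vertices. -/
structure Conf.Represents (C : Conf ι m Γ₀) (G : ι → DAG n) (x : Fin d → Fin n) : Prop where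
  tape : ∀ r, C.tape r = encodeGraph (G r).1
  passed : C.passed = []
  scratch : C.counter .scratch = 0
  val_of_lt : ∀ (v : Fin m) (h : v < d), C.counter (.val v) = x ⟨v, h⟩
  val_of_le : ∀ v : Fin m, d ≤ v → C.counter (.val v) = 0
  rest_of_le : ∀ v : Fin m, d ≤ v → C.counter (.rest v) = n

theorem Conf.Represents.with_truth {C : Conf ι m Γ₀} {G : ι → DAG n} {x : Fin d → Fin n}
    (h : C.Represents G x) (l : List Bool) : { C with truth := l }.Represents G x :=
  { h with }

theorem Conf.Represents.snoc {C : Conf ι m Γ₀} {G : ι → DAG n} {x : Fin d → Fin n}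
    (h : C.Represents G x) (hm : d < m) (y : Fin n) (p : ℕ) :
    ((C.setCounter (.val ⟨d, hm⟩) y).setCounter (.rest ⟨d, hm⟩) p).Represents G
      (Fin.snoc x y : Fin (d + 1) → Fin n) where
  tape := h.tape
  passed := h.passed
  scratch := by simpa [Conf.setCounter] using h.scratch
  val_of_lt v hv := by
    obtain hlt | heq := Nat.lt_succ_iff_lt_or_eq.1 hv
    · have hne : v ≠ ⟨d, hm⟩ := fun h => hlt.ne (congrArg Fin.val h)
      simpa [Conf.setCounter, Fin.snoc, hne, hlt] using h.val_of_lt v hlt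
    · have hv' : v = ⟨d, hm⟩ := Fin.ext heq
      subst hv'
      simp [Conf.setCounter, Fin.snoc]
  val_of_le v hv := by
    have hne : v ≠ ⟨d, hm⟩ := fun h => (Nat.lt_of_succ_le hv).ne' (congrArg Fin.val h)
    simpa [Conf.setCounter, hne] using h.val_of_le v (Nat.le_of_succ_le hv)
  rest_of_le v hv := by
    have hne : v ≠ ⟨d, hm⟩ := fun h => (Nat.lt_of_succ_le hv).ne' (congrArg Fin.val h)
    simpa [Conf.setCounter, hne] using h.rest_of_le v (Nat.le_of_succ_le hv)

open Filter in
open scoped Classical in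
/-- The property `P` of families of DAGs with `d` distinguished vertices can be evaluated in
polynomial time by stack programs with sufficiently many counters. -/
def PolyTimeEvaluable (ι Γ₀ : Type) (d : ℕ)
    (P : ∀ n, (ι → DAG n) → (Fin d → Fin n) → Prop) : Prop :=
  ∀ᶠ m in atTop, ∃ (c : StackProgram (Alphabet ι m Γ₀) (Register Γ₀)) (p : Polynomial ℕ),
    ∀ (n : ℕ) (G : ι → DAG n) (x : Fin d → Fin n) (C : Conf ι m Γ₀), C.Represents G x →
      c.Transforms C.stk { C with truth := decide (P n G x) :: C.truth }.stk (p.eval n)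

namespace PolyTimeEvaluable

variable {ι Γ₀ : Type} {d : ℕ} {P Q : ∀ n, (ι → DAG n) → (Fin d → Fin n) → Prop}

theorem congr (hP : PolyTimeEvaluable ι Γ₀ d P) (h : ∀ n G x, P n G x ↔ Q n G x) :
    PolyTimeEvaluable ι Γ₀ d Q := by
  have hPQ : P = Q := by
    funext n G x
    exact propext (h n G x)
  exact hPQ ▸ hP

theorem op (F : Prop → Prop → Prop) (hP : PolyTimeEvaluable ι Γ₀ d P)
    (hQ : PolyTimeEvaluable ι Γ₀ d Q) :
    PolyTimeEvaluable ι Γ₀ d fun n G x => F (P n G x) (Q n G x) := by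
  classical
  filter_upwards [hP, hQ] with m ⟨c, p, hc⟩ ⟨c', q, hc'⟩
  refine ⟨c.seq (c'.seq (connect fun a b => decide (F a b))), p + (q + 3), fun n G x C hC => ?_⟩
  have hseq := (hc n G x C hC).seq ((hc' n G x _ (hC.with_truth _)).seq
    (transforms_connect (fun a b => decide (F a b)) C _ _))
  simpa using hseq

theorem not (hP : PolyTimeEvaluable ι Γ₀ d P) : PolyTimeEvaluable ι Γ₀ d fun n G x => ¬P n G x :=
  hP.op (fun p _ => ¬p) hP

theorem all {P : ∀ n, (ι → DAG n) → (Fin (d + 1) → Fin n) → Prop}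
    (hP : PolyTimeEvaluable ι Γ₀ (d + 1) P) :
    PolyTimeEvaluable ι Γ₀ d fun n G x => ∀ y, P n G (Fin.snoc x y) := by
  classical
  filter_upwards [hP, Filter.eventually_gt_atTop d] with m ⟨c, p, hc⟩ hm
  refine ⟨(push .truth fun _ => true).seq
    (cycle (.rest ⟨d, hm⟩) (.val ⟨d, hm⟩) (c.seq (connect and))),
    1 + (.X * (p + 3 + 2) + 1 + (.X * 2 + 1)), fun n G x C hC => ?_⟩
  let A (i : ℕ) : Bool := decide (∀ y : Fin n, y < i → P n G (Fin.snoc x y))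
  have hzero : A 0 = true := by simp [A]
  have hsucc (i : ℕ) (hi : i < n) : A (i + 1) = (A i && decide (P n G (Fin.snoc x ⟨i, hi⟩))) := by
    rw [← Bool.decide_and, decide_eq_decide]
    refine ⟨fun h => ⟨fun y hy => h y (by omega), h _ i.lt_succ_self⟩, fun h y hy => ?_⟩
    obtain hlt | heq := Nat.lt_succ_iff_lt_or_eq.1 hy
    · exact h.1 y hlt
    · exact (Fin.ext heq : y = ⟨i, hi⟩) ▸ h.2
  have hall : A n = @decide (∀ y, P n G (Fin.snoc x y)) (Classical.propDecidable _) := by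
    simp [A]
  have hpush := transforms_push_const (Γ := Alphabet ι m Γ₀) (σ := Register Γ₀) .truth true C.stk
  rw [Conf.update_truth] at hpush
  have hcycle := transforms_cycle (c := .rest ⟨d, hm⟩) (c' := .val ⟨d, hm⟩)
    (body := c.seq (connect and)) (N := p.eval n + 3) (by simp)
    (fun i => { C with truth := A i :: C.truth }) (hC.rest_of_le _ le_rfl)
    (hC.val_of_le _ le_rfl) (hC.rest_of_le _ le_rfl) (hC.val_of_le _ le_rfl) fun i hi => ?_
  · rw [hzero, hall] at hcycle
    simpa using hpush.seq hcycle
  · rw [hsucc i hi]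
    exact (hc n G _ _ ((hC.snoc hm ⟨i, hi⟩ (n - (i + 1))).with_truth (A i :: C.truth))).seq
      (transforms_connect and ((C.setCounter _ _).setCounter _ _) (A i) _)

theorem adj (r : ι) (v w : Fin d) :
    PolyTimeEvaluable ι Γ₀ d fun _ G x => (G r).1.Adj (x v) (x w) := by
  classical
  filter_upwards [Filter.eventually_ge_atTop d] with m hm
  refine ⟨query r (v.castLE hm) (w.castLE hm), .X * (.X * 2 + 4) + .X * 8 + .X * (.X + 1) * 2 + 8,
    fun n G x C hC => ?_⟩
  simpa using transforms_query (hC.tape r) hC.passed hC.scratch (hC.val_of_lt (v.castLE hm) v.2)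
    (hC.val_of_lt (w.castLE hm) w.2)

theorem eq (r : ι) (v w : Fin d) : PolyTimeEvaluable ι Γ₀ d fun _ _ x => x v = x w :=
  ((adj r v w).op And (adj r w v)).congr fun _ G _ =>
    ⟨fun h => (G r).2.antisymm h.1 h.2, fun h => h ▸ ⟨(G r).1.loop _, (G r).1.loop _⟩⟩

theorem linked (r : ι) (v w : Fin d) :
    PolyTimeEvaluable ι Γ₀ d fun _ G x => (G r).1.Linked (x v) (x w) :=
  (adj r v w).op Or (adj r w v)

theorem twins (r : ι) (v w : Fin d) :
    PolyTimeEvaluable ι Γ₀ d fun _ G x => (G r).1.Twins (x v) (x w) := by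
  have h := (linked (Γ₀ := Γ₀) r v.castSucc (.last d)).op Iff (linked r w.castSucc (.last d))
  simpa only [LoopedDigraph.Twins, Fin.snoc_castSucc, Fin.snoc_last] using h.all

theorem shielded (r : ι) (v : Fin d) :
    PolyTimeEvaluable ι Γ₀ d fun _ G x => (G r).1.Shielded (x v) := by
  let a : Fin (d + 2) := (Fin.last d).castSucc
  let b : Fin (d + 2) := .last (d + 1)
  let i : Fin (d + 2) := v.castSucc.castSucc
  have hgrandparent := (adj (Γ₀ := Γ₀) r b a).op (· → ·) ((adj r a i).op (· → ·) (linked r b i))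
  have hgrandchild := (adj (Γ₀ := Γ₀) r i a).op (· → ·) ((adj r a b).op (· → ·) (linked r b i))
  have hsibling := (adj (Γ₀ := Γ₀) r a i).op (· → ·) ((adj r a b).op (· → ·) (linked r b i))
  have hparent := (adj (Γ₀ := Γ₀) r a i).op (· → ·) ((adj r i b).op (· → ·) (linked r a b))
  have hall := (hgrandparent.op And (hgrandchild.op And (hsibling.op And hparent))).all.all
  refine hall.congr fun n G x => ?_
  simp only [a, b, i, Fin.snoc_castSucc, Fin.snoc_last]
  exact ⟨fun h => ⟨fun {a b} => (h a b).1, fun {a b} => (h a b).2.1, fun {a b} => (h a b).2.2.1,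
    fun {a b} => (h a b).2.2.2⟩, fun h a b => ⟨h.grandparent, h.grandchild, h.sibling,
    h.parent_child⟩⟩

theorem reversible (r : ι) (v w : Fin d) :
    PolyTimeEvaluable ι Γ₀ d fun _ G x => (G r).1.Reversible (x v) (x w) := by
  let i : Fin (d + 1) := v.castSucc
  let j : Fin (d + 1) := w.castSucc
  let k : Fin (d + 1) := .last d
  have hparent := (adj (Γ₀ := Γ₀) r k i).op Iff (adj r k j)
  have hchild := (adj (Γ₀ := Γ₀) r i k).op Iff (adj r j k)
  have hneighbors := ((eq r k i).not.op (· → ·) ((eq r k j).not.op (· → ·)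
    (hparent.op And hchild))).all
  have hedge := (eq (Γ₀ := Γ₀) r v w).not.op And (adj r v w)
  refine ((hedge.op And hneighbors).op And ((shielded r v).op And (shielded r w))).congr
    fun n G x => ?_
  simp only [i, j, k, Fin.snoc_castSucc, Fin.snoc_last]
  exact ⟨fun h => ⟨h.1.1.1, h.1.1.2, fun {k} hi hj => (h.1.2 k hi hj).1,
    fun {k} hi hj => (h.1.2 k hi hj).2, h.2.1, h.2.2⟩, fun h => ⟨⟨⟨h.ne, h.adj⟩,
    fun k hi hj => ⟨h.parent hi hj, h.child hi hj⟩⟩, h.shielded_left, h.shielded_right⟩⟩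

theorem locallyEquivalent (r s : ι) :
    PolyTimeEvaluable ι Γ₀ 0 fun _ G _ => (G r).1.LocallyEquivalent (G s).1 := by
  let i : Fin 2 := 0
  let j : Fin 2 := 1
  have hlinked := (linked (Γ₀ := Γ₀) r i j).op Iff (linked s i j)
  have hreversed := (eq (Γ₀ := Γ₀) r i j).not.op And ((adj r i j).op And (adj s j i))
  have hlocal := (twins (Γ₀ := Γ₀) r i j).op And ((shielded r i).op And (shielded r j))
  refine (hlinked.op And (hreversed.op (· → ·) hlocal)).all.all.congr fun n G x => ?_
  have hi (a b : Fin n) : (Fin.snoc (Fin.snoc x a : Fin 1 → Fin n) b : Fin 2 → Fin n) i = a := rfl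
  have hj (a b : Fin n) : (Fin.snoc (Fin.snoc x a : Fin 1 → Fin n) b : Fin 2 → Fin n) j = b := rfl
  simp only [hi, hj]
  exact ⟨fun h => ⟨⟨fun {a b} => (h a b).1, fun {a b} hab => ((h a b).2 hab).1⟩,
    fun {a b} hab => ((h a b).2 hab).2⟩, fun h a b => ⟨h.linked, fun hab =>
    ⟨h.twins hab, h.shielded hab⟩⟩⟩

theorem forall_not_reversible (r : ι) :
    PolyTimeEvaluable ι Γ₀ 0 fun _ G _ => ∀ i j, ¬(G r).1.Reversible i j :=
  (reversible r 0 1).not.all.all.congr fun _ _ _ => Iff.rfl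

end PolyTimeEvaluable

end StackProgram

namespace StackProgram

variable {ι : Type} {m : ℕ} {Γ₀ : Type}

section Store

variable [Inhabited Γ₀]

/-- Put the symbol in the register back to the input and write its translation by `g`, if any, on
a tape. -/
def storeSymbol (g : Γ₀ → Option (Option Bool)) (r : ι) :
    StackProgram (Alphabet ι m Γ₀) (Register Γ₀) :=
  (push .input fun s => s.symbol.getD default).seq
    (ite (fun s => (s.symbol.bind g).isSome) (push (.tape r) fun s => (s.symbol.bind g).getD none)
      (load id))

/-- Move the input to the buffer. -/
def reverseInput : StackProgram (Alphabet ι m Γ₀) (Register Γ₀) :=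
  loop .input (fun s o => { s with symbol := o }) (fun s => s.symbol.isSome)
    (push .buffer fun s => s.symbol.getD default)

/-- Write the translation of the input on a tape. The input is reversed first, since the last
symbol has to be written first. -/
def storeTape (g : Γ₀ → Option (Option Bool)) (r : ι) :
    StackProgram (Alphabet ι m Γ₀) (Register Γ₀) :=
  reverseInput.seq <|
    loop .buffer (fun s o => { s with symbol := o }) (fun s => s.symbol.isSome) (storeSymbol g r)

variable [DecidableEq ι]

theorem runsWithin_storeSymbol {g : Γ₀ → Option (Option Bool)} {r : ι} (C : Conf ι m Γ₀)
    {s : Register Γ₀} {a : Γ₀} (hs : s.symbol = some a) :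
    (storeSymbol g r).RunsWithin s C.stk
      { C with
        input := a :: C.input
        tape := Function.update C.tape r ((g a).toList ++ C.tape r) }.stk 3 := by
  let D : Conf ι m Γ₀ := { C with input := a :: C.input }
  have hinput := Runs.push (Γ := Alphabet ι m Γ₀) .input
    (fun s : Register Γ₀ => s.symbol.getD default) s C.stk
  rw [Conf.update_input, hs] at hinput
  have hwrite : (ite (fun s : Register Γ₀ => (s.symbol.bind g).isSome)
      (push (.tape r) fun s => (s.symbol.bind g).getD none) (load id)).RunsWithin s D.stk
      { D with tape := Function.update D.tape r ((g a).toList ++ D.tape r) }.stk (1 + 1) := by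
    refine RunsWithin.ite (fun ht => ?_) fun ht => ?_
    · obtain ⟨b, hb⟩ : ∃ b, g a = some b := Option.isSome_iff_exists.1 (by simpa [hs] using ht)
      have hpush := runsWithin_push (Γ := Alphabet ι m Γ₀) (.tape r)
        (fun s : Register Γ₀ => (s.symbol.bind g).getD none) s D.stk
      have htape : D.stk (.tape r) = D.tape r := rfl
      rw [Conf.update_tape, htape] at hpush
      simpa [hs, hb] using hpush
    · have hnone : g a = none := by simpa [hs] using ht
      simpa [hnone] using transforms_load (Γ := Alphabet ι m Γ₀) id D.stk s
  obtain ⟨s', k, hk, hr⟩ := hwrite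
  exact ⟨s', 1 + k, by omega, hinput.seq hr⟩

theorem transforms_reverseInput {C : Conf ι m Γ₀} (hbuffer : C.buffer = []) :
    reverseInput.Transforms C.stk { C with input := [], buffer := C.input.reverse }.stk
      (C.input.length * 2 + 1) := by
  have h := transforms_transfer (Γ := Alphabet ι m Γ₀) (k := .input) (k' := .buffer)
    (by simp) (f := fun (s : Register Γ₀) o => { s with symbol := o })
    (t := fun s => s.symbol.isSome) (g := fun s => s.symbol.getD default) id (fun _ => rfl)
    (fun _ _ => ⟨rfl, rfl⟩) C.stk
  have hreverse : ((C.stk .input).map id).reverse ++ C.stk .buffer = C.input.reverse := by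
    simp [Conf.stk, hbuffer]
  rwa [Conf.update_input, Conf.update_buffer, hreverse] at h

theorem transforms_storeTape (g : Γ₀ → Option (Option Bool)) {r : ι} {C : Conf ι m Γ₀}
    (hbuffer : C.buffer = []) (htape : C.tape r = []) :
    (storeTape g r).Transforms C.stk
      { C with tape := Function.update C.tape r (C.input.filterMap g) }.stk
      (C.input.length * 2 + 1 + (C.input.length * 4 + 1)) := by
  obtain ⟨l, hl⟩ : ∃ l, l = C.input.reverse := ⟨_, rfl⟩
  let F (i : ℕ) : Conf ι m Γ₀ := { C with
    input := (l.take i).reverse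
    buffer := l.drop i
    tape := Function.update C.tape r ((l.take i).reverse.filterMap g) }
  have hstore : (loop .buffer _ _ (storeSymbol g r)).Transforms (F 0).stk _ _ :=
    transforms_loop (Γ := Alphabet ι m Γ₀) (f := fun (s : Register Γ₀) o => { s with symbol := o })
      (t := fun s => s.symbol.isSome) (N := 3) (fun i => (F i).stk) (m := l.length)
      (fun i hi s => ?_) fun s => ?_
  · have hstart : F 0 = { C with input := [], buffer := l } := by
      have htape' : Function.update C.tape r [] = C.tape := by rw [← htape, Function.update_eq_self]
      simp [F, htape']
    have hend : F l.length = { C with tape := Function.update C.tape r (C.input.filterMap g) } := by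
      simp only [F, List.take_length, List.drop_length, hbuffer]
      rw [hl, List.reverse_reverse]
    have hnil : (F l.length).stk .buffer = [] := List.drop_length
    rw [hnil, hend, hstart, Conf.update_buffer] at hstore
    rw [hl, List.length_reverse] at hstore
    exact hbuffer ▸ (transforms_reverseInput hbuffer).seq hstore
  · have hhead : (F i).stk .buffer = l[i] :: l.drop (i + 1) := List.drop_eq_getElem_cons hi
    rw [hhead, Conf.update_buffer]
    refine ⟨rfl, ?_⟩
    have h := runsWithin_storeSymbol (g := g) (r := r) { F i with buffer := l.drop (i + 1) }
      (s := { s with symbol := some l[i] }) rfl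
    have htake : (l.take (i + 1)).reverse = l[i] :: (l.take i).reverse := by
      rw [List.take_succ_eq_append_getElem hi, List.reverse_concat]
    have hnext : F (i + 1) = { F i with
        input := l[i] :: (F i).input
        buffer := l.drop (i + 1)
        tape := Function.update (F i).tape r ((g l[i]).toList ++ (F i).tape r) } := by
      simp only [F, htake, List.filterMap_cons, Function.update_self, Function.update_idem]
      cases g l[i] <;> rfl
    rw [hnext]
    exact h
  · have hnil : (F l.length).stk .buffer = [] := List.drop_length
    rw [hnil]
    rfl

end Store

section Count

/-- The counters when no variable has a value. -/
def restCounter (z : Fin m → ℕ) : Counter m → ℕ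
  | .rest v => z v
  | _ => 0

theorem restCounter_zero : (restCounter fun _ : Fin m => 0) = fun _ => 0 := by
  funext c
  cases c <;> rfl

theorem update_restCounter (z : Fin m → ℕ) (v : Fin m) (k : ℕ) :
    Function.update (restCounter z) (.rest v) k = restCounter (Function.update z v k) := by
  funext c
  cases c
  case rest w => by_cases h : w = v <;> [subst h; skip] <;> simp [restCounter, *]
  all_goals simp [restCounter]

/-- For each variable, count the input symbols that satisfy `mark`. -/
noncomputable def countMarks (mark : Γ₀ → Bool) : StackProgram (Alphabet ι m Γ₀) (Register Γ₀) :=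
  loop .input (fun s o => { s with symbol := o }) (fun s => s.symbol.isSome)
    (ite (fun s => s.symbol.any mark) (forAll fun v => incr (.rest v)) (load id))

variable [DecidableEq ι]

theorem transforms_forAll_incr (C : Conf ι m Γ₀) (k : ℕ) :
    (forAll fun v => incr (.rest v) : StackProgram (Alphabet ι m Γ₀) (Register Γ₀)).Transforms
      { C with counter := restCounter fun _ : Fin m => k }.stk
      { C with counter := restCounter fun _ : Fin m => k + 1 }.stk (m + 1) := by
  have h := transforms_forAll (σ := Register Γ₀) (N := 1) (body := fun v : Fin m => incr (.rest v))
    (fun z => Conf.stk { C with counter := restCounter z }) (fun _ => k) (fun _ => k + 1)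
    fun v z hz => ?_
  · simpa using h
  · have hv := transforms_incr (.rest v) { C with counter := restCounter z } k
    simpa [Conf.setCounter, update_restCounter, ← hz] using hv

theorem transforms_countMarks (mark : Γ₀ → Bool) {C : Conf ι m Γ₀}
    (hC : C.counter = restCounter fun _ => 0) :
    (countMarks mark).Transforms C.stk
      { C with input := [], counter := restCounter fun _ : Fin m => C.input.countP mark }.stk
      (C.input.length * (1 + (m + 1) + 1) + 1) := by
  let F (i : ℕ) : Conf ι m Γ₀ := { C with
    input := C.input.drop i
    counter := restCounter fun _ => (C.input.take i).countP mark }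
  have h : (countMarks mark).Transforms (F 0).stk _ _ :=
    transforms_loop (fun i => (F i).stk) (m := C.input.length)
      (N := 1 + (m + 1)) (fun i hi s => ?_) fun s => ?_
  · have hnil : (F C.input.length).stk .input = [] := List.drop_length
    rw [hnil, Conf.update_input] at h
    simpa [F, ← hC] using h
  · have hhead : (F i).stk .input = C.input[i] :: C.input.drop (i + 1) :=
      List.drop_eq_getElem_cons hi
    have hcount : (C.input.take (i + 1)).countP mark =
        (C.input.take i).countP mark + if mark C.input[i] then 1 else 0 := by
      rw [List.take_succ_eq_append_getElem hi, List.countP_append, List.countP_singleton]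
    rw [hhead, Conf.update_input]
    refine ⟨rfl, RunsWithin.ite (fun ht => ?_) fun ht => ?_⟩
    · have hmark : mark C.input[i] = true := ht
      have h := transforms_forAll_incr { C with input := C.input.drop (i + 1) }
        ((C.input.take i).countP mark)
      simpa only [F, hcount, hmark, if_true, List.tail_cons] using h _
    · have hmark : mark C.input[i] = false := ht
      have h := transforms_load (Γ := Alphabet ι m Γ₀) (σ := Register Γ₀) id
        { F i with input := C.input.drop (i + 1) }.stk
      simpa [F, hcount, hmark] using (h _).mono (Nat.le_add_left 1 m)
  · have hnil : (F C.input.length).stk .input = [] := List.drop_length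
    rw [hnil]
    rfl

end Count

section Start

variable [Fintype ι]

/-- Write the translations of the input on the tapes, and erase it while setting the counters. -/
noncomputable def initialise [Inhabited Γ₀] (g : ι → Γ₀ → Option (Option Bool))
    (mark : Γ₀ → Bool) : StackProgram (Alphabet ι m Γ₀) (Register Γ₀) :=
  (forAll fun r => storeTape (g r) r).seq (countMarks mark)

theorem transforms_initialise [DecidableEq ι] [Inhabited Γ₀] (g : ι → Γ₀ → Option (Option Bool))
    (mark : Γ₀ → Bool) (w : List Γ₀) :
    (initialise g mark).Transforms ({ input := w } : Conf ι m Γ₀).stk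
      ({ tape := fun r => w.filterMap (g r)
         counter := restCounter fun _ => w.countP mark } : Conf ι m Γ₀).stk
      (Fintype.card ι * (w.length * 2 + 1 + (w.length * 4 + 1)) + 1 +
        (w.length * (1 + (m + 1) + 1) + 1)) :=
  (transforms_forAll (Γ := Alphabet ι m Γ₀)
    (fun z => ({ input := w, tape := z } : Conf ι m Γ₀).stk) _ _
    fun r _ hz => transforms_storeTape (g r) rfl hz).seq
      (transforms_countMarks mark restCounter_zero.symm)

/-- Empty a tape. -/
def clearTape (r : ι) : StackProgram (Alphabet ι m Γ₀) (Register Γ₀) :=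
  loop (.tape r) (fun s o => { s with cell := o }) (fun s => s.cell.isSome) (load id)

/-- Empty the tapes and the counters. -/
noncomputable def cleanUp : StackProgram (Alphabet ι m Γ₀) (Register Γ₀) :=
  (forAll clearTape).seq (forAll fun v => countdown (.rest v) (load id))

variable [DecidableEq ι]

theorem transforms_clearTapes {C : Conf ι m Γ₀} {k : ℕ} (hk : ∀ r, (C.tape r).length = k) :
    (forAll clearTape).Transforms C.stk { C with tape := fun _ => [] }.stk
      (Fintype.card ι * (k * 2 + 1) + 1) := by
  refine transforms_forAll (Γ := Alphabet ι m Γ₀) (fun z => { C with tape := z }.stk) _ _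
    fun r z hz => ?_
  have h := transforms_clear (Γ := Alphabet ι m Γ₀) (k := .tape r)
    (f := fun (s : Register Γ₀) o => { s with cell := o }) (t := fun s => s.cell.isSome)
    (fun _ => rfl) (fun _ _ => rfl) { C with tape := z }.stk
  have hlength : ({ C with tape := z }.stk (.tape r)).length = k :=
    (congrArg List.length hz).trans (hk r)
  rwa [Conf.update_tape, hlength] at h

theorem transforms_cleanUp {C : Conf ι m Γ₀} {k n : ℕ} (hk : ∀ r, (C.tape r).length = k)
    (hn : C.counter = restCounter fun _ => n) :
    cleanUp.Transforms C.stk { C with tape := fun _ => [], counter := fun _ => 0 }.stk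
      (Fintype.card ι * (k * 2 + 1) + 1 + (m * (n * (1 + 1) + 1) + 1)) := by
  let D (z : Fin m → ℕ) : Conf ι m Γ₀ := { C with tape := fun _ => [], counter := restCounter z }
  have hcounters := transforms_forAll (σ := Register Γ₀) (N := n * (1 + 1) + 1)
    (body := fun v : Fin m => countdown (.rest v) (load id)) (fun z => (D z).stk) (fun _ => n)
    (fun _ => 0) fun v z hz => ?_
  · rw [Fintype.card_fin] at hcounters
    simp only [D, ← hn, restCounter_zero] at hcounters
    exact (transforms_clearTapes hk).seq hcounters
  · have h := transforms_countdown (c := .rest v) (k := n) (fun _ => D z)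
      fun _ _ => transforms_load (Γ := Alphabet ι m Γ₀) (σ := Register Γ₀) id _
    simpa only [Conf.setCounter, D, update_restCounter, ← hz, Function.update_eq_self] using h

end Start

end StackProgram

namespace StackProgram

section Decide

variable {ι Γ₀ : Type} {m n : ℕ}

theorem Conf.stk_empty : ({} : Conf ι m Γ₀).stk = fun _ => [] := by
  funext k
  cases k <;> rfl

theorem Conf.represents_of_restCounter (G : ι → DAG n) :
    ({ tape := fun r => encodeGraph (G r).1, counter := restCounter fun _ => n } :
      Conf ι m Γ₀).Represents G Fin.elim0 where
  tape _ := rfl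
  passed := rfl
  scratch := rfl
  val_of_lt _ h := absurd h (Nat.not_lt_zero _)
  val_of_le _ _ := rfl
  rest_of_le _ _ := rfl

theorem eval_le_eval_of_le (p : Polynomial ℕ) {m n : ℕ} (h : m ≤ n) : p.eval m ≤ p.eval n := by
  rw [Polynomial.eval_eq_sum_range, Polynomial.eval_eq_sum_range]
  gcongr

open Polynomial in
open scoped Classical in
theorem exists_transforms_decide [Finite ι] [Inhabited Γ₀]
    {Q : ∀ n, (ι → DAG n) → (Fin 0 → Fin n) → Prop} (hQ : PolyTimeEvaluable ι Γ₀ 0 Q)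
    (g : ι → Γ₀ → Option (Option Bool)) (mark : Γ₀ → Bool) :
    ∃ (m : ℕ) (c : StackProgram (Alphabet ι m Γ₀) (Register Γ₀)) (q : ℕ[X]),
      ∀ (n : ℕ) (G : ι → DAG n) (w : List Γ₀), (∀ r, w.filterMap (g r) = encodeGraph (G r).1) →
        w.countP mark = n → c.Transforms ({ input := w } : Conf ι m Γ₀).stk
          ({ truth := [decide (Q n G Fin.elim0)] } : Conf ι m Γ₀).stk (q.eval w.length) := by
  cases nonempty_fintype ι
  obtain ⟨m, c, p, hc⟩ := hQ.exists
  let q : ℕ[X] := C (Fintype.card ι) * (X * 2 + 1 + (X * 4 + 1)) + 1 +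
    (X * (1 + (C m + 1) + 1) + 1) +
    (p + (C (Fintype.card ι) * (X * (X + 1) * 2 + 1) + 1 + (C m * (X * (1 + 1) + 1) + 1)))
  refine ⟨m, (initialise g mark).seq (c.seq cleanUp), q, fun n G w hg hmark => ?_⟩
  have hinit := transforms_initialise (m := m) g mark w
  simp only [hg, hmark] at hinit
  have heval := hc n G Fin.elim0 _ (Conf.represents_of_restCounter G)
  have hclean := transforms_cleanUp (m := m) (Γ₀ := Γ₀)
    (C := { tape := fun r => encodeGraph (G r).1
            counter := restCounter fun _ => n
            truth := [decide (Q n G Fin.elim0)] })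
    (fun r => length_encodeGraph (G r).1) rfl
  refine (hinit.seq (heval.seq hclean)).mono ?_
  have hn : n ≤ w.length := hmark ▸ List.countP_le_length
  have hp := eval_le_eval_of_le p hn
  simp only [q, eval_add, eval_mul, eval_X, eval_one, eval_ofNat, eval_C]
  gcongr

open scoped Classical in
theorem PolyTimeEvaluable.decidableInPolyTime [Finite ι] [Finite Γ₀] [Inhabited Γ₀]
    {Q : ∀ n, (ι → DAG n) → (Fin 0 → Fin n) → Prop} (hQ : PolyTimeEvaluable ι Γ₀ 0 Q)
    {α : Type} {enc : α → List Γ₀} {P : α → Prop} (I : α → Σ n, ι → DAG n)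
    {g : ι → Γ₀ → Option (Option Bool)} {mark : Γ₀ → Bool}
    (hg : ∀ a r, (enc a).filterMap (g r) = encodeGraph ((I a).2 r).1)
    (hmark : ∀ a, (enc a).countP mark = (I a).1) (hP : ∀ a, P a ↔ Q (I a).1 (I a).2 Fin.elim0) :
    DecidableInPolyTime enc P := by
  cases nonempty_fintype ι
  obtain ⟨m, c, q, hc⟩ := exists_transforms_decide hQ g mark
  let s₀ : Register Γ₀ := ⟨none, none, false, false⟩
  refine decidableInPolyTime_of_runs (Γ := Alphabet ι m Γ₀) (k₀ := .input) (k₁ := .truth)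
    (c.seq (load fun _ => s₀)) s₀ (Equiv.refl _) (Equiv.refl _) (q + 1)
    (fun a => decide (Q (I a).1 (I a).2 Fin.elim0)) (fun a => by rw [decide_eq_true_iff, hP])
    fun a => ?_
  obtain ⟨s, k, hk, hr⟩ := hc (I a).1 (I a).2 (enc a) (hg a) (hmark a) s₀
  refine ⟨k + 1, by simpa using hk, ?_⟩
  have h := hr.seq (Runs.load (fun _ => s₀) _ _)
  rw [← Conf.stk_empty, Conf.update_input, Conf.update_truth]
  simpa using h

end Decide

theorem countP_isNone_encodeGraph {n : ℕ} (G : LoopedDigraph (Fin n)) :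
    (encodeGraph G).countP Option.isNone = n := by
  simp [encodeGraph, adjRows, List.countP_flatten, List.map_ofFn, Function.comp_def,
    List.countP_append, List.countP_eq_zero.2]

theorem decidableInPolyTime_encodeDAG {P : ∀ n, DAG n → Prop}
    (hP : PolyTimeEvaluable Unit (Option Bool) 0 fun n G _ => P n (G ())) :
    DecidableInPolyTime encodeDAG fun x => P x.1 x.2 :=
  hP.decidableInPolyTime (fun x => ⟨x.1, fun _ => x.2⟩) (g := fun _ => some) (mark := Option.isNone)
    (fun _ _ => List.filterMap_some) (fun x => countP_isNone_encodeGraph x.2.1) fun _ => Iff.rfl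

theorem decidableInPolyTime_encodeDAGPair {P : ∀ n, DAG n → DAG n → Prop}
    (hP : PolyTimeEvaluable Bool (Option Bool ⊕ Option Bool) 0
      fun n G _ => P n (G false) (G true)) :
    DecidableInPolyTime encodeDAGPair fun x => P x.1 x.2.1 x.2.2 := by
  refine hP.decidableInPolyTime (fun x => ⟨x.1, fun r => if r then x.2.2 else x.2.1⟩)
    (g := fun r a => if r then a.getRight? else a.getLeft?)
    (mark := fun a => (a.getLeft?.map Option.isNone).getD false) ?_ (fun x => ?_) fun _ => Iff.rfl
  · rintro x (_ | _) <;>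
      simp [encodeDAGPair, List.filterMap_append, List.filterMap_map, Function.comp_def]
  · simpa [encodeDAGPair, List.countP_append, List.countP_map, Function.comp_def]
      using countP_isNone_encodeGraph x.2.1.1

end StackProgram

theorem mainTheorem8 (c : ∀ n : ℕ, Fin n → ℝ) (hc : ∀ n i, 0 < c n i) :
    DecidableInPolyTime encodeDAG
      (fun x : (Σ n : ℕ, DAG n) =>
        StructurallyIdentifiableWithin (Matrix.diagonal (c x.1))
          {H : LoopedDigraph (Fin x.1) | H.IsAcyclic} x.2.1) ∧
    DecidableInPolyTime encodeDAGPair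
      (fun x : (Σ n : ℕ, DAG n × DAG n) =>
        ModelEquivalent (Matrix.diagonal (c x.1)) x.2.1.1 x.2.2.1) := by
  constructor
  · have h := StackProgram.decidableInPolyTime_encodeDAG
      (P := fun _ G => ∀ i j, ¬G.1.Reversible i j) (.forall_not_reversible ())
    simpa only [LoopedDigraph.structurallyIdentifiableWithin_iff (hc _) (Subtype.prop _)] using h
  · have h := StackProgram.decidableInPolyTime_encodeDAGPair
      (P := fun _ G H => G.1.LocallyEquivalent H.1) (.locallyEquivalent false true)
    simpa only [LoopedDigraph.modelEquivalent_iff (hc _) (Subtype.prop _) (Subtype.prop _)] using h
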